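/- Let $\Omega\subseteq\mathbb C$ be an open set containing $0$, with closure $\overline\Omega$ in $\mathbb C$. Let $A^\infty(\Omega)$ be the set of all holomorphic functions $f$ on $\Omega$ such that every derivative $f^{(l)}$, $l=0,1,2,\dots$, extends continuously to $\overline\Omega$ (the extension is again denoted $f^{(l)}$), with the metric \[ \rho(f,g)=\sum_{l=0}^\infty\sum_{n=1}^\infty\frac1{2^{l+n}}\min\Big\{\sup_{z\in\overline\Omega,\ |z|\le n}|f^{(l)}(z)-g^{(l)}(z)|,\,1\Big\}. \] Let $H(\overline\Omega)\subseteq A^\infty(\Omega)$ be the set of restrictions to $\Omega$ of functions holomorphic on some open set (depending on the function) containing $\overline\Omega$, and let $X$ be the closure of $H(\overline\Omega)$ in $(A^\infty(\Omega),\rho)$. For $f\in A^\infty(\Omega)$ let $a_v=f^{(v)}(0)/v!$ for $v\ge0$ and $a_v=0$ for $v<0$. For integers $p,q\ge0$ write $f\in D_{p,q}$ if $q=0$, or if $q\ge1$ and $\det\big(a_{p-q+1+i+j}\big)_{0\le i,j\le q-1}\ne0$. In that case $[p/q]_f$ denotes the Padé approximant of $f$: the unique rational function of the form $N/D$ with polynomials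 $N,D$, $\deg N\le p$, $\deg D\le q$, $D(0)=1$, whose Taylor coefficients at $0$ of orders $0,1,\dots,p+q$ are $a_0,a_1,\dots,a_{p+q}$. Let $F\subseteq\mathbb N\times\mathbb N$ contain a sequence $(\tilde p_m,\tilde q_m)_m$ with $\tilde p_m\to\infty$ and $\tilde q_m\to\infty$. Let $B_F$ be the set of all $f\in A^\infty(\Omega)$ for which there is a sequence $(p_m,q_m)_m$ in $F$ such that $f\in D_{p_m,q_m}$ for all $m$ and, for every compact $K\subseteq\overline\Omega$, $[p_m/q_m]_f$ has no poles in $K$ for all sufficiently large $m$ and $[p_m/q_m]_f^{(l)}\to f^{(l)}$ uniformly on $K$ for each $l=0,1,2,\dots$. Then $B_F\cap X$ is a $G_\delta$ subset of $X$ and is dense in $X$. In particular $B_F\neq\emptyset$. -/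

import Mathlib

open Set Filter Topology Polynomial

noncomputable section

/-! ### The space `A^∞(Ω)` -/

/-- The `l`-th complex derivative of a function `f` on `Ω`. For open `Ω` its values at the points
of `Ω` do not depend on how `f` is continued to the rest of the plane (here: by `0`). -/
def derivOn (Ω : Set ℂ) (l : ℕ) (f : Ω → ℂ) : ℂ → ℂ :=
  iteratedDeriv l (Function.extend Subtype.val f 0)

/-- `A^∞(Ω)`: the holomorphic functions on `Ω` all of whose derivatives extend continuously to
the closure of `Ω`. -/
structure AInfty (Ω : Set ℂ) where
  /-- the function on `Ω` -/
  toFun : Ω → ℂ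
  holo : DifferentiableOn ℂ (Function.extend Subtype.val toFun 0) Ω
  extends_closure : ∀ l : ℕ, ∃ g : ℂ → ℂ,
    ContinuousOn g (closure Ω) ∧ EqOn g (derivOn Ω l toFun) Ω

namespace AInfty

variable {Ω : Set ℂ}

/-- The continuous extension of `f^{(l)}` to the closure of `Ω` (only the values there matter). -/
def bar (f : AInfty Ω) (l : ℕ) : ℂ → ℂ :=
  extendFrom Ω (derivOn Ω l f.toFun)

theorem continuousOn_bar (f : AInfty Ω) (l : ℕ) : ContinuousOn (f.bar l) (closure Ω) := by
  obtain ⟨g, hg, hgf⟩ := f.extends_closure l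
  refine continuousOn_extendFrom subset_rfl fun x hx => ⟨g x, ?_⟩
  exact ((hg x hx).mono subset_closure).tendsto.congr' (hgf.eventuallyEq_of_mem self_mem_nhdsWithin)

theorem bar_eqOn (f : AInfty Ω) (l : ℕ) : EqOn (f.bar l) (derivOn Ω l f.toFun) Ω := by
  obtain ⟨g, hg, hgf⟩ := f.extends_closure l
  intro x hx
  refine extendFrom_eq (subset_closure hx) ?_
  rw [← hgf hx]
  exact ((hg x (subset_closure hx)).mono subset_closure).tendsto.congr'
    (hgf.eventuallyEq_of_mem self_mem_nhdsWithin)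

/-- `‖f - g‖_{l,n}`, the supremum of `|f^{(l)} - g^{(l)}|` over the points of the closure of `Ω`
in the closed disc of radius `n` about `0`. -/
def supDist (l n : ℕ) (f g : AInfty Ω) : ℝ :=
  ⨆ z : ↥(closure Ω ∩ Metric.closedBall (0 : ℂ) (n : ℝ)), ‖f.bar l z - g.bar l z‖

/-- The metric `ρ(f,g) = ∑_{l ≥ 0} ∑_{n ≥ 1} 2^{-(l+n)} min{‖f - g‖_{l,n}, 1}`. -/
def rho (f g : AInfty Ω) : ℝ :=
  ∑' l : ℕ, ∑' n : ℕ, 1 / 2 ^ (l + (n + 1)) * min (supDist l (n + 1) f g) 1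

theorem bddAbove_supDist (l n : ℕ) (f g : AInfty Ω) :
    BddAbove (range fun z : ↥(closure Ω ∩ Metric.closedBall (0 : ℂ) (n : ℝ)) =>
      ‖f.bar l z - g.bar l z‖) := by
  have hK : IsCompact (closure Ω ∩ Metric.closedBall (0 : ℂ) (n : ℝ)) :=
    (isCompact_closedBall _ _).inter_left isClosed_closure
  have hc : ContinuousOn (fun z => ‖f.bar l z - g.bar l z‖)
      (closure Ω ∩ Metric.closedBall (0 : ℂ) (n : ℝ)) :=
    (((f.continuousOn_bar l).sub (g.continuousOn_bar l)).norm).mono inter_subset_left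
  have := hK.bddAbove_image hc
  rwa [image_eq_range] at this

theorem le_supDist (l n : ℕ) (f g : AInfty Ω) {z : ℂ} (hz : z ∈ closure Ω) (hn : ‖z‖ ≤ n) :
    ‖f.bar l z - g.bar l z‖ ≤ supDist l n f g :=
  le_ciSup (bddAbove_supDist l n f g) ⟨z, hz, by simpa using hn⟩

theorem supDist_nonneg (l n : ℕ) (f g : AInfty Ω) : 0 ≤ supDist l n f g :=
  Real.iSup_nonneg fun _ => norm_nonneg _

theorem supDist_self (l n : ℕ) (f : AInfty Ω) : supDist l n f f = 0 := by
  simp [supDist]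

theorem supDist_comm (l n : ℕ) (f g : AInfty Ω) : supDist l n f g = supDist l n g f := by
  simp only [supDist, norm_sub_rev]

theorem supDist_triangle (l n : ℕ) (f g h : AInfty Ω) :
    supDist l n f h ≤ supDist l n f g + supDist l n g h := by
  refine Real.iSup_le (fun z => ?_) (add_nonneg (supDist_nonneg ..) (supDist_nonneg ..))
  have hz : ‖(z : ℂ)‖ ≤ n := by simpa using z.2.2
  exact (norm_sub_le_norm_sub_add_norm_sub _ (g.bar l z) _).trans
    (add_le_add (le_supDist l n f g z.2.1 hz) (le_supDist l n g h z.2.1 hz))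

theorem term_nonneg (l n : ℕ) (f g : AInfty Ω) :
    0 ≤ 1 / 2 ^ (l + (n + 1)) * min (supDist l (n + 1) f g) 1 :=
  mul_nonneg (by positivity) (le_min (supDist_nonneg ..) zero_le_one)

theorem term_le (l n : ℕ) (f g : AInfty Ω) :
    1 / 2 ^ (l + (n + 1)) * min (supDist l (n + 1) f g) 1 ≤ (1 / 2) ^ l * (1 / 2) ^ (n + 1) := by
  rw [← pow_add, one_div_pow]
  exact mul_le_of_le_one_right (by positivity) (min_le_right _ _)

theorem summable_geom_succ : Summable fun n : ℕ => ((1 : ℝ) / 2) ^ (n + 1) :=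
  (summable_nat_add_iff 1).2 summable_geometric_two

theorem summable_inner (l : ℕ) (f g : AInfty Ω) :
    Summable fun n : ℕ => 1 / 2 ^ (l + (n + 1)) * min (supDist l (n + 1) f g) 1 :=
  Summable.of_nonneg_of_le (fun n => term_nonneg l n f g) (fun n => term_le l n f g)
    (summable_geom_succ.mul_left _)

theorem summable_outer (f g : AInfty Ω) :
    Summable fun l : ℕ => ∑' n : ℕ, 1 / 2 ^ (l + (n + 1)) * min (supDist l (n + 1) f g) 1 := by
  refine Summable.of_nonneg_of_le (fun l => tsum_nonneg fun n => term_nonneg l n f g)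
    (fun l => ?_) (summable_geometric_two.mul_right (∑' n : ℕ, ((1 : ℝ) / 2) ^ (n + 1)))
  rw [← tsum_mul_left]
  exact (summable_inner l f g).tsum_le_tsum (fun n => term_le l n f g)
    (summable_geom_succ.mul_left _)

theorem rho_triangle (f g h : AInfty Ω) : rho f h ≤ rho f g + rho g h := by
  unfold rho
  rw [← (summable_outer f g).tsum_add (summable_outer g h)]
  refine (summable_outer f h).tsum_le_tsum (fun l => ?_)
    ((summable_outer f g).add (summable_outer g h))
  rw [← (summable_inner l f g).tsum_add (summable_inner l g h)]
  refine (summable_inner l f h).tsum_le_tsum (fun n => ?_)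
    ((summable_inner l f g).add (summable_inner l g h))
  rw [← mul_add]
  refine mul_le_mul_of_nonneg_left ?_ (by positivity)
  have h1 := supDist_triangle l (n + 1) f g h
  have h2 := supDist_nonneg l (n + 1) f g
  have h3 := supDist_nonneg l (n + 1) g h
  rcases min_cases (supDist l (n + 1) f g) 1 with h4 | h4 <;>
  rcases min_cases (supDist l (n + 1) g h) 1 with h5 | h5 <;>
  rcases min_cases (supDist l (n + 1) f h) 1 with h6 | h6 <;> linarith

theorem eq_of_rho_eq_zero (f g : AInfty Ω) (h : rho f g = 0) : f = g := by
  have h0 : HasSum (fun l : ℕ => ∑' n : ℕ, 1 / 2 ^ (l + (n + 1)) *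
      min (supDist l (n + 1) f g) 1) 0 := by
    have := (summable_outer f g).hasSum
    unfold rho at h
    rwa [h] at this
  have h1 : ∑' n : ℕ, 1 / 2 ^ (0 + (n + 1)) * min (supDist 0 (n + 1) f g) 1 = 0 := by
    have := (hasSum_zero_iff_of_nonneg
      (fun l => tsum_nonneg fun n => term_nonneg l n f g)).1 h0
    exact congrFun this 0
  have h2 : ∀ n : ℕ, supDist 0 (n + 1) f g = 0 := by
    intro n
    have h1' := (summable_inner 0 f g).hasSum
    rw [h1] at h1'
    have := (hasSum_zero_iff_of_nonneg (fun n => term_nonneg 0 n f g)).1 h1'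
    have h3 : 1 / 2 ^ (0 + (n + 1)) * min (supDist 0 (n + 1) f g) 1 = 0 := congrFun this n
    rcases mul_eq_zero.1 h3 with h4 | h4
    · exact absurd h4 (by positivity)
    · rcases min_cases (supDist 0 (n + 1) f g) 1 with h5 | h5 <;> linarith
  have h3 : f.toFun = g.toFun := by
    funext z
    obtain ⟨n, hn⟩ := exists_nat_ge ‖(z : ℂ)‖
    have h4 := le_supDist 0 (n + 1) f g (subset_closure z.2) (hn.trans (by push_cast; linarith))
    rw [h2 n, bar_eqOn f 0 z.2, bar_eqOn g 0 z.2] at h4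
    have h5 := sub_eq_zero.1 (norm_le_zero_iff.1 h4)
    simpa [derivOn, Subtype.val_injective.extend_apply] using h5
  cases f; cases g; simp_all

instance : MetricSpace (AInfty Ω) where
  dist := rho
  dist_self f := by simp [rho, supDist_self]
  dist_comm f g := by simp [rho, supDist_comm _ _ f g]
  dist_triangle := rho_triangle
  eq_of_dist_eq_zero := eq_of_rho_eq_zero _ _

/-- The Taylor coefficients of `f` at `0`. -/
def taylor (f : AInfty Ω) (v : ℕ) : ℂ :=
  derivOn Ω v f.toFun 0 / (v.factorial : ℂ)

end AInfty

/-- `H(closure Ω)` as a subset of `A^∞(Ω)`: the functions that are restrictions to `Ω` of a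
function holomorphic on some open set containing the closure of `Ω`. -/
def holoClosure (Ω : Set ℂ) : Set (AInfty Ω) :=
  {f | ∃ (U : Set ℂ) (h : ℂ → ℂ), IsOpen U ∧ closure Ω ⊆ U ∧ DifferentiableOn ℂ h U ∧
    ∀ z : Ω, f.toFun z = h z}

/-! ### Padé approximants of the power series `∑ a_v z^v` -/

/-- `a_k` for integers `k`, with `a_k = 0` for `k < 0`. -/
def coeffZ (a : ℕ → ℂ) (k : ℤ) : ℂ :=
  if 0 ≤ k then a k.toNat else 0

/-- The condition `f ∈ D_{p,q}`: the `q × q` determinant with entries `a_{p-q+1+i+j}`,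
`0 ≤ i, j < q`, does not vanish (for `q = 0` this holds trivially). -/
def InD (p q : ℕ) (a : ℕ → ℂ) : Prop :=
  (Matrix.of fun i j : Fin q =>
    coeffZ a ((p : ℤ) - (q : ℤ) + 1 + ((i : ℕ) : ℤ) + ((j : ℕ) : ℤ))).det ≠ 0

/-- `R` is a `[p/q]` Padé approximant: `R = N / D` with `deg N ≤ p`, `deg D ≤ q`, `D(0) = 1`,
and the Taylor series `N · D⁻¹` of `R` at `0` has the coefficients `a_v` for `v ≤ p + q`. -/
def IsPade (p q : ℕ) (a : ℕ → ℂ) (R : RatFunc ℂ) : Prop :=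
  ∃ N D : ℂ[X], N.natDegree ≤ p ∧ D.natDegree ≤ q ∧ D.coeff 0 = 1 ∧
    R = algebraMap ℂ[X] (RatFunc ℂ) N / algebraMap ℂ[X] (RatFunc ℂ) D ∧
    ∀ v ≤ p + q, PowerSeries.coeff v ((N : PowerSeries ℂ) * (D : PowerSeries ℂ)⁻¹) = a v

/-- There is at most one Padé approximant of a given type. -/
theorem IsPade.unique {p q : ℕ} {a : ℕ → ℂ} {R S : RatFunc ℂ}
    (hR : IsPade p q a R) (hS : IsPade p q a S) : R = S := by
  obtain ⟨N, D, hN, hD, hD0, rfl, h⟩ := hR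
  obtain ⟨N', D', hN', hD', hD0', rfl, h'⟩ := hS
  have hDne : D ≠ 0 := by rintro rfl; simp at hD0
  have hDne' : D' ≠ 0 := by rintro rfl; simp at hD0'
  have key : N * D' = N' * D := by
    ext v
    by_cases hv : v ≤ p + q
    · have c1 : (D : PowerSeries ℂ)⁻¹ * D = 1 := PowerSeries.inv_mul_cancel _ (by
        rw [Polynomial.constantCoeff_coe, hD0]; exact one_ne_zero)
      have c2 : (D' : PowerSeries ℂ)⁻¹ * D' = 1 := PowerSeries.inv_mul_cancel _ (by
        rw [Polynomial.constantCoeff_coe, hD0']; exact one_ne_zero)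
      have f1 : ((N * D' : ℂ[X]) : PowerSeries ℂ) =
          ((N : PowerSeries ℂ) * (D : PowerSeries ℂ)⁻¹) * ((D * D' : ℂ[X]) : PowerSeries ℂ) := by
        push_cast
        calc (N : PowerSeries ℂ) * D' = N * ((D : PowerSeries ℂ)⁻¹ * D) * D' := by rw [c1, mul_one]
          _ = _ := by ring
      have f2 : ((N' * D : ℂ[X]) : PowerSeries ℂ) =
          ((N' : PowerSeries ℂ) * (D' : PowerSeries ℂ)⁻¹) * ((D * D' : ℂ[X]) : PowerSeries ℂ) := by
        push_cast
        calc (N' : PowerSeries ℂ) * D = N' * ((D' : PowerSeries ℂ)⁻¹ * D') * D := by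
              rw [c2, mul_one]
          _ = _ := by ring
      rw [← Polynomial.coeff_coe, ← Polynomial.coeff_coe, f1, f2, PowerSeries.coeff_mul,
        PowerSeries.coeff_mul]
      refine Finset.sum_congr rfl fun x hx => ?_
      have hx' := Finset.HasAntidiagonal.mem_antidiagonal.1 hx
      rw [h x.1 (by omega), h' x.1 (by omega)]
    · have d1 : (N * D').natDegree < v := lt_of_le_of_lt Polynomial.natDegree_mul_le (by omega)
      have d2 : (N' * D).natDegree < v := lt_of_le_of_lt Polynomial.natDegree_mul_le (by omega)
      rw [Polynomial.coeff_eq_zero_of_natDegree_lt d1, Polynomial.coeff_eq_zero_of_natDegree_lt d2]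
  rw [div_eq_div_iff (by simpa using hDne) (by simpa using hDne'), ← map_mul, ← map_mul, key]

open Classical in
/-- The Padé approximant `[p/q]` of `∑ a_v z^v` (`0` by convention if there is none). -/
def pade (p q : ℕ) (a : ℕ → ℂ) : RatFunc ℂ :=
  if h : ∃ R, IsPade p q a R then h.choose else 0

/-- The `l`-th derivative of a rational function, as a function on the complement of its poles. -/
def ratDeriv (l : ℕ) (R : RatFunc ℂ) : ℂ → ℂ :=
  iteratedDeriv l fun z => R.eval (RingHom.id ℂ) z

/-- `R` has no poles in `K` (`R.denom` is the denominator of `R` in lowest terms). -/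
def NoPolesIn (R : RatFunc ℂ) (K : Set ℂ) : Prop :=
  ∀ z ∈ K, R.denom.eval z ≠ 0

/-- `B_F`: the `f ∈ A^∞(Ω)` for which there is a sequence `(p_m, q_m)` in `F` such that
`f ∈ D_{p_m,q_m}` for all `m`, and on every compact subset `K` of the closure of `Ω`, for every
`l`, the functions `[p_m/q_m]_f^{(l)}` (which have no poles in `K` for `m` large) converge
uniformly to `f^{(l)}`. -/
def BSet (Ω : Set ℂ) (F : Set (ℕ × ℕ)) : Set (AInfty Ω) :=
  {f | ∃ u : ℕ → ℕ × ℕ, (∀ m, u m ∈ F) ∧ (∀ m, InD (u m).1 (u m).2 f.taylor) ∧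
    ∀ K ⊆ closure Ω, IsCompact K →
      (∀ᶠ m in atTop, NoPolesIn (pade (u m).1 (u m).2 f.taylor) K) ∧
      ∀ l : ℕ, TendstoUniformlyOn (fun m => ratDeriv l (pade (u m).1 (u m).2 f.taylor))
        (f.bar l) atTop K}

end

/-!
Let `G(p, q, s)` be the set of those `f ∈ D_{p,q}` whose Padé approximant has no poles in
`closure Ω ∩ {|z| ≤ s}` and is `1 / (s + 1)`-close to `f` there, together with its derivatives up
to order `s`. Then `B_F = ⋂ s, ⋃ (p, q) ∈ F, G(p, q, s)`. Cramer's rule expresses numerator and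
denominator through finitely many Taylor coefficients, which depend continuously on `f`, so
`G(p, q, s)` is open by compactness. `A^∞(Ω)` is complete, and Baire's theorem in `X` reduces
everything to the density of each union.

Rational functions without poles in `closure Ω` are dense in `X`: cut off a function holomorphic
near `closure Ω` and write it, by the Cauchy–Pompeiu formula, as an integral of Cauchy kernels with
poles off `closure Ω`. Adding `c z ^ t` to such a rational function `R`, with `c` small and `t`
large, keeps its denominator and gives its numerator any prescribed large degree `p`. A reduced
fraction with numerator of degree exactly `p` and denominator of degree at most `q` lies in
`D_{p,q}` and is its own `[p/q]` Padé approximant, hence lies in `G(p, q, s)` for every `s`.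
-/

/-! ### The topology of `A^∞(Ω)` -/

namespace AInfty

variable {Ω : Set ℂ}

theorem supDist_mono (l : ℕ) {m n : ℕ} (h : m ≤ n) (f g : AInfty Ω) :
    supDist l m f g ≤ supDist l n f g := by
  refine Real.iSup_le (fun z => ?_) (supDist_nonneg ..)
  have hz : ‖(z : ℂ)‖ ≤ m := by simpa using z.2.2
  exact le_supDist l n f g z.2.1 (hz.trans (by exact_mod_cast h))

theorem min_supDist_le_dist (l n : ℕ) (f g : AInfty Ω) :
    min (supDist l (n + 1) f g) 1 ≤ 2 ^ (l + (n + 1)) * dist f g := by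
  have hterm : 1 / 2 ^ (l + (n + 1)) * min (supDist l (n + 1) f g) 1 ≤ dist f g :=
    ((summable_inner l f g).le_tsum n fun m _ => term_nonneg l m f g).trans
      ((summable_outer f g).le_tsum l fun k _ => tsum_nonneg fun m => term_nonneg k m f g)
  rwa [one_div, inv_mul_le_iff₀ (by positivity)] at hterm

theorem exists_supDist_lt_of_dist_lt (l n : ℕ) {ε : ℝ} (hε : 0 < ε) :
    ∃ δ > 0, ∀ f g : AInfty Ω, dist f g < δ → supDist l n f g < ε := by
  refine ⟨min ε 1 / 2 ^ (l + (n + 1)), by positivity, fun f g h => ?_⟩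
  rw [lt_div_iff₀ (by positivity), mul_comm] at h
  have hmin : min (supDist l (n + 1) f g) 1 < min ε 1 := (min_supDist_le_dist l n f g).trans_lt h
  exact (supDist_mono l n.le_succ f g).trans_lt (lt_of_not_ge fun hle =>
    hmin.not_ge (min_le_min_right 1 hle))

theorem tendsto_of_tendsto_supDist {ι : Type*} {p : Filter ι} {u : ι → AInfty Ω} {f : AInfty Ω}
    (h : ∀ l n : ℕ, Tendsto (fun i => supDist l n (u i) f) p (𝓝 0)) : Tendsto u p (𝓝 f) := by
  rw [tendsto_iff_dist_tendsto_zero]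
  have hterm (l n : ℕ) : Tendsto
      (fun i => 1 / 2 ^ (l + (n + 1)) * min (supDist l (n + 1) (u i) f) 1) p (𝓝 0) := by
    simpa using ((h l (n + 1)).min (tendsto_const_nhds (x := (1 : ℝ)))).const_mul
      ((1 : ℝ) / 2 ^ (l + (n + 1)))
  have hinner (l : ℕ) : Tendsto (fun i => ∑' n : ℕ,
      1 / 2 ^ (l + (n + 1)) * min (supDist l (n + 1) (u i) f) 1) p (𝓝 0) := by
    simpa using tendsto_tsum_of_dominated_convergence (g := fun _ => (0 : ℝ))
      (summable_geom_succ.mul_left (((1 : ℝ) / 2) ^ l)) (hterm l)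
      (Eventually.of_forall fun i n => by
        rw [Real.norm_of_nonneg (term_nonneg ..)]; exact term_le l n (u i) f)
  have houter : Tendsto (fun i => rho (u i) f) p (𝓝 (∑' _ : ℕ, (0 : ℝ))) :=
    tendsto_tsum_of_dominated_convergence
      (summable_geometric_two.mul_right (∑' n : ℕ, ((1 : ℝ) / 2) ^ (n + 1)))
      hinner (Eventually.of_forall fun i l => by
        rw [Real.norm_of_nonneg (tsum_nonneg fun n => term_nonneg l n _ _), ← tsum_mul_left]
        exact (summable_inner l _ f).tsum_le_tsum (fun n => term_le l n _ f)
          (summable_geom_succ.mul_left _))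
  rwa [tsum_zero] at houter

theorem tendsto_of_tendstoUniformlyOn_bar {ι : Type*} {p : Filter ι} {u : ι → AInfty Ω}
    {f : AInfty Ω} (h : ∀ l n : ℕ, TendstoUniformlyOn (fun i => (u i).bar l) (f.bar l) p
      (closure Ω ∩ Metric.closedBall 0 n)) : Tendsto u p (𝓝 f) := by
  refine tendsto_of_tendsto_supDist fun l n => Metric.tendsto_nhds.2 fun ε hε => ?_
  filter_upwards [Metric.tendstoUniformlyOn_iff.1 (h l n) (ε / 2) (half_pos hε)] with i hi
  rw [Real.dist_0_eq_abs, abs_of_nonneg (supDist_nonneg ..)]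
  refine lt_of_le_of_lt (Real.iSup_le (fun z => ?_) (half_pos hε).le) (half_lt_self hε)
  rw [← dist_eq_norm, dist_comm]
  exact (hi z z.2).le

theorem continuous_bar_uncurry (l n : ℕ) :
    Continuous fun x : AInfty Ω × ↥(closure Ω ∩ Metric.closedBall (0 : ℂ) (n : ℝ)) =>
      x.1.bar l x.2 := by
  refine continuous_iff_continuousAt.2 fun ⟨f, z⟩ => Metric.continuousAt_iff'.2 fun ε hε => ?_
  obtain ⟨δ, hδ, hdist⟩ := exists_supDist_lt_of_dist_lt (Ω := Ω) l n (half_pos hε)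
  have hcont : Continuous fun w : ↥(closure Ω ∩ Metric.closedBall (0 : ℂ) (n : ℝ)) => f.bar l w :=
    ((f.continuousOn_bar l).mono inter_subset_left).domRestrict
  have hnear := Metric.continuousAt_iff'.1 (hcont.continuousAt (x := z)) (ε / 2) (half_pos hε)
  rw [nhds_prod_eq]
  refine ((eventually_mem_set.2 (Metric.ball_mem_nhds f hδ)).prod_mk hnear).mono ?_
  rintro ⟨g, w⟩ ⟨hg, hw⟩
  have hgf : dist (g.bar l w) (f.bar l w) < ε / 2 := by
    rw [dist_eq_norm]
    exact (le_supDist l n g f w.2.1 (by simpa using w.2.2)).trans_lt (hdist g f hg)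
  calc dist (g.bar l w) (f.bar l z)
      ≤ dist (g.bar l w) (f.bar l w) + dist (f.bar l w) (f.bar l z) := dist_triangle _ _ _
    _ < ε / 2 + ε / 2 := add_lt_add hgf hw
    _ = ε := add_halves ε

theorem continuous_bar (l : ℕ) {z : ℂ} (hz : z ∈ closure Ω) :
    Continuous fun f : AInfty Ω => f.bar l z := by
  obtain ⟨n, hn⟩ := exists_nat_ge ‖z‖
  exact (continuous_bar_uncurry l n).comp
    (Continuous.prodMk_left (⟨z, hz, mem_closedBall_zero_iff.2 hn⟩ :
      ↥(closure Ω ∩ Metric.closedBall (0 : ℂ) (n : ℝ))))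

theorem continuous_taylor (h0 : (0 : ℂ) ∈ Ω) (v : ℕ) :
    Continuous fun f : AInfty Ω => f.taylor v := by
  have htaylor (f : AInfty Ω) : f.taylor v = f.bar v 0 / (v.factorial : ℂ) := by
    rw [taylor, ← bar_eqOn f v h0]
  simp_rw [htaylor]
  exact (continuous_bar v (subset_closure h0)).div_const _

end AInfty

/-! ### Completeness -/

section LocallyUniform

variable {ι α β : Type*} [PseudoMetricSpace α] [UniformSpace β] {S : Set α} {x : α}

theorem exists_forall_tendstoUniformlyOn_inter_closedBall [CompleteSpace β] {u : ℕ → α → β}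
    (h : ∀ n : ℕ, UniformCauchySeqOn u atTop (S ∩ Metric.closedBall x n)) :
    ∃ g : α → β, ∀ n : ℕ, TendstoUniformlyOn u g atTop (S ∩ Metric.closedBall x n) := by
  have hlim (z : α) : ∃ c, z ∈ S → Tendsto (fun k => u k z) atTop (𝓝 c) := by
    by_cases hz : z ∈ S
    · obtain ⟨n, hn⟩ := exists_nat_ge (dist z x)
      obtain ⟨c, hc⟩ := cauchySeq_tendsto_of_complete ((h n).cauchySeq ⟨hz, hn⟩)
      exact ⟨c, fun _ => hc⟩
    · exact ⟨u 0 z, fun hz' => absurd hz' hz⟩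
  choose g hg using hlim
  exact ⟨g, fun n => (h n).tendstoUniformlyOn_of_tendsto fun z hz => hg z hz.1⟩

theorem tendstoLocallyUniformlyOn_of_inter_closedBall {p : Filter ι} {u : ι → α → β} {g : α → β}
    (h : ∀ n : ℕ, TendstoUniformlyOn u g p (S ∩ Metric.closedBall x n)) :
    TendstoLocallyUniformlyOn u g p S := by
  intro s hs z _
  obtain ⟨n, hn⟩ := exists_nat_gt (dist z x)
  exact ⟨S ∩ Metric.closedBall x n, inter_mem self_mem_nhdsWithin (mem_nhdsWithin_of_mem_nhds
    (Metric.closedBall_mem_nhds_of_mem hn)), h n s hs⟩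

end LocallyUniform

section IteratedDeriv

variable {E : Type*} [NormedAddCommGroup E] [NormedSpace ℂ E] [CompleteSpace E] {U : Set ℂ}

theorem differentiableOn_iteratedDeriv {f : ℂ → E} (hf : DifferentiableOn ℂ f U) (hU : IsOpen U)
    (l : ℕ) : DifferentiableOn ℂ (iteratedDeriv l f) U := by
  induction l with
  | zero => simpa using hf
  | succ l ih => rw [iteratedDeriv_succ]; exact ih.deriv hU

theorem tendstoLocallyUniformlyOn_iteratedDeriv {ι : Type*} {p : Filter ι} {u : ι → ℂ → E}
    {f : ℂ → E} (h : TendstoLocallyUniformlyOn u f p U) (hu : ∀ i, DifferentiableOn ℂ (u i) U)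
    (hU : IsOpen U) (l : ℕ) :
    TendstoLocallyUniformlyOn (fun i => iteratedDeriv l (u i)) (iteratedDeriv l f) p U := by
  induction l with
  | zero => simpa using h
  | succ l ih =>
    simp only [iteratedDeriv_succ]
    exact ih.deriv (Eventually.of_forall fun i => differentiableOn_iteratedDeriv (hu i) hU l) hU

end IteratedDeriv

theorem eqOn_extend_val {Ω : Set ℂ} {f : Ω → ℂ} {h : ℂ → ℂ} (hf : ∀ z : Ω, f z = h z) :
    EqOn (Function.extend Subtype.val f 0) h Ω := fun z hz => by
  rw [← hf ⟨z, hz⟩]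
  exact Subtype.val_injective.extend_apply f 0 ⟨z, hz⟩

theorem derivOn_eqOn {Ω : Set ℂ} (hΩ : IsOpen Ω) {f : Ω → ℂ} {h : ℂ → ℂ}
    (hf : ∀ z : Ω, f z = h z) (l : ℕ) : EqOn (derivOn Ω l f) (iteratedDeriv l h) Ω :=
  (eqOn_extend_val hf).iteratedDeriv_of_isOpen hΩ l

namespace AInfty

variable {Ω : Set ℂ}

/-- The element of `A^∞(Ω)` given by a function `h` on the plane which is holomorphic on `Ω`. -/
def ofFun (hΩ : IsOpen Ω) (h : ℂ → ℂ) (hh : DifferentiableOn ℂ h Ω)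
    (hext : ∀ l, ∃ g : ℂ → ℂ, ContinuousOn g (closure Ω) ∧ EqOn g (iteratedDeriv l h) Ω) :
    AInfty Ω where
  toFun z := h z
  holo := hh.congr (eqOn_extend_val fun _ => rfl)
  extends_closure l := by
    obtain ⟨g, hg, hgh⟩ := hext l
    exact ⟨g, hg, hgh.trans (derivOn_eqOn hΩ (fun _ => rfl) l).symm⟩

theorem bar_eqOn_closure (hΩ : IsOpen Ω) {f : AInfty Ω} {h g : ℂ → ℂ} {l : ℕ}
    (hf : ∀ z : Ω, f.toFun z = h z) (hg : ContinuousOn g (closure Ω))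
    (hgh : EqOn g (iteratedDeriv l h) Ω) : EqOn (f.bar l) g (closure Ω) := fun x hx =>
  extendFrom_eq hx (((hg x hx).mono subset_closure).tendsto.congr'
    ((hgh.trans (derivOn_eqOn hΩ hf l).symm).eventuallyEq_of_mem self_mem_nhdsWithin))

theorem uniformCauchySeqOn_bar {u : ℕ → AInfty Ω} (hu : CauchySeq u) (l n : ℕ) :
    UniformCauchySeqOn (fun k => (u k).bar l) atTop (closure Ω ∩ Metric.closedBall 0 n) := by
  refine Metric.uniformCauchySeqOn_iff.2 fun ε hε => ?_
  obtain ⟨δ, hδ, hdist⟩ := exists_supDist_lt_of_dist_lt (Ω := Ω) l n hε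
  obtain ⟨N, hN⟩ := Metric.cauchySeq_iff.1 hu δ hδ
  refine ⟨N, fun i hi j hj z hz => ?_⟩
  rw [dist_eq_norm]
  exact (le_supDist l n _ _ hz.1 (by simpa using hz.2)).trans_lt (hdist _ _ (hN i hi j hj))

theorem exists_bar_eqOn_of_tendstoLocallyUniformlyOn (hΩ : IsOpen Ω) {ι : Type*} {p : Filter ι}
    [p.NeBot] {u : ι → AInfty Ω} {g : ℕ → ℂ → ℂ}
    (h : ∀ l, TendstoLocallyUniformlyOn (fun k => (u k).bar l) (g l) p (closure Ω)) :
    ∃ f : AInfty Ω, ∀ l, EqOn (f.bar l) (g l) (closure Ω) := by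
  have hcont (l : ℕ) : ContinuousOn (g l) (closure Ω) :=
    (h l).continuousOn (Frequently.of_forall fun k => (u k).continuousOn_bar l)
  have hderivOn (l : ℕ) :
      TendstoLocallyUniformlyOn (fun k => derivOn Ω l (u k).toFun) (g l) p Ω :=
    ((h l).mono subset_closure).congr fun k => (u k).bar_eqOn l
  have hu (k : ι) : DifferentiableOn ℂ (derivOn Ω 0 (u k).toFun) Ω := by
    simpa only [derivOn, iteratedDeriv_zero] using (u k).holo
  have hderiv (l : ℕ) : EqOn (g l) (iteratedDeriv l (g 0)) Ω := fun z hz => by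
    have := tendstoLocallyUniformlyOn_iteratedDeriv (hderivOn 0) hu hΩ l
    simp only [derivOn, iteratedDeriv_zero] at this
    exact tendsto_nhds_unique ((hderivOn l).tendsto_at hz) (this.tendsto_at hz)
  refine ⟨ofFun hΩ (g 0) ((hderivOn 0).differentiableOn (Eventually.of_forall hu) hΩ)
    fun l => ⟨g l, hcont l, hderiv l⟩, fun l => ?_⟩
  exact bar_eqOn_closure hΩ (fun _ => rfl) (hcont l) (hderiv l)

theorem completeSpace (hΩ : IsOpen Ω) : CompleteSpace (AInfty Ω) := by
  refine Metric.complete_of_cauchySeq_tendsto fun u hu => ?_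
  choose g hg using fun l =>
    exists_forall_tendstoUniformlyOn_inter_closedBall (uniformCauchySeqOn_bar hu l)
  obtain ⟨f, hf⟩ := exists_bar_eqOn_of_tendstoLocallyUniformlyOn hΩ fun l =>
    tendstoLocallyUniformlyOn_of_inter_closedBall (hg l)
  exact ⟨f, tendsto_of_tendstoUniformlyOn_bar fun l n =>
    (hg l n).congr_right ((hf l).symm.mono inter_subset_left)⟩

end AInfty

/-! ### The algebra of Padé approximants -/

theorem coeffZ_natCast_sub (a : ℕ → ℂ) (k t : ℕ) :
    coeffZ a ((k : ℤ) - t) = if t ≤ k then a (k - t) else 0 := by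
  unfold coeffZ
  split_ifs <;> first | omega | rfl | (congr 1; omega)

/-- The Hankel matrix whose determinant decides `f ∈ D_{p,q}`. -/
def hankel (p q : ℕ) (a : ℕ → ℂ) : Matrix (Fin q) (Fin q) ℂ :=
  Matrix.of fun i j : Fin q =>
    coeffZ a ((p : ℤ) - (q : ℤ) + 1 + ((i : ℕ) : ℤ) + ((j : ℕ) : ℤ))

theorem inD_iff_det_hankel_ne_zero {p q : ℕ} {a : ℕ → ℂ} : InD p q a ↔ (hankel p q a).det ≠ 0 :=
  Iff.rfl

theorem coeff_ofFn_mul_mk {q : ℕ} (w : Fin q → ℂ) (a : ℕ → ℂ) (k : ℕ) :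
    PowerSeries.coeff k ((ofFn q w : PowerSeries ℂ) * PowerSeries.mk a) =
      ∑ t : Fin q, w t * coeffZ a ((k : ℤ) - (t : ℕ)) := by
  rw [ofFn_eq_sum_monomial, ← coeToPowerSeries.ringHom_apply, map_sum, Finset.sum_mul, map_sum]
  refine Finset.sum_congr rfl fun t _ => ?_
  rw [coeToPowerSeries.ringHom_apply, coe_monomial, PowerSeries.monomial_eq_C_mul_X_pow, mul_assoc,
    PowerSeries.coeff_C_mul, PowerSeries.coeff_X_pow_mul', PowerSeries.coeff_mk,
    coeffZ_natCast_sub]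

theorem coeff_ofFn_rev_mul_mk {p q : ℕ} (w : Fin q → ℂ) (a : ℕ → ℂ) (i : Fin q) :
    PowerSeries.coeff (p + i) ((ofFn q (w ∘ Fin.rev) : PowerSeries ℂ) * PowerSeries.mk a) =
      (hankel p q a).mulVec w i := by
  rw [coeff_ofFn_mul_mk, ← Equiv.sum_comp Fin.revPerm]
  refine Finset.sum_congr rfl fun j _ => ?_
  simp only [hankel, Matrix.of_apply, Function.comp_apply, Fin.revPerm_apply, Fin.rev_rev,
    Fin.val_rev]
  rw [mul_comm]
  congr 2
  omega

theorem eq_zero_of_X_pow_dvd_coe {R : Type*} [CommSemiring R] {P : R[X]} {n : ℕ}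
    (hP : P.degree < n) (h : (PowerSeries.X : PowerSeries R) ^ n ∣ (P : PowerSeries R)) :
    P = 0 := by
  ext m
  rcases lt_or_ge m n with hm | hm
  · simpa using PowerSeries.X_pow_dvd_iff.1 h m hm
  · exact coeff_eq_zero_of_degree_lt (hP.trans_le (by exact_mod_cast hm))

theorem inD_iff_forall_coeff {p q : ℕ} {a : ℕ → ℂ} :
    InD p q a ↔ ∀ W : ℂ[X], W.degree < q →
      (∀ i < q, PowerSeries.coeff (p + i) ((W : PowerSeries ℂ) * PowerSeries.mk a) = 0) →
      W = 0 := by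
  rw [inD_iff_det_hankel_ne_zero, Ne, ← Matrix.exists_mulVec_eq_zero_iff]
  push Not
  constructor
  · intro h W hW hcoeff
    obtain ⟨w, rfl⟩ : ∃ w : Fin q → ℂ, ofFn q (w ∘ Fin.rev) = W := by
      refine ⟨toFn q W ∘ Fin.rev, ?_⟩
      ext t
      rcases lt_or_ge t q with ht | ht
      · simp [ofFn_coeff_eq_val_of_lt _ ht, toFn]
      · rw [ofFn_coeff_eq_zero_of_ge _ ht, coeff_eq_zero_of_degree_lt
          (hW.trans_le (by exact_mod_cast ht))]
    have hw : w = 0 := by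
      by_contra hw
      refine h w hw (funext fun i => ?_)
      rw [← coeff_ofFn_rev_mul_mk, hcoeff i i.2, Pi.zero_apply]
    rw [hw, Pi.zero_comp, ofFn_zero]
  · intro h w hw hmul
    have hrev := h (ofFn q (w ∘ Fin.rev)) (ofFn_degree_lt _) fun i hi => by
      rw [coeff_ofFn_rev_mul_mk w a ⟨i, hi⟩, hmul, Pi.zero_apply]
    refine hw (funext fun j => ?_)
    simpa using congrFun (injective_ofFn q (hrev.trans (ofFn_zero q).symm)) j.rev

theorem inD_iff_forall_X_pow_dvd {p q : ℕ} {a : ℕ → ℂ} :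
    InD p q a ↔ ∀ W M : ℂ[X], W.degree < q → M.degree < p →
      PowerSeries.X ^ (p + q) ∣ (W : PowerSeries ℂ) * PowerSeries.mk a - (M : PowerSeries ℂ) →
      W = 0 := by
  rw [inD_iff_forall_coeff]
  refine ⟨fun h W M hW hM hdvd => h W hW fun i hi => ?_, fun h W hW hcoeff =>
    h W (PowerSeries.trunc p ((W : PowerSeries ℂ) * PowerSeries.mk a)) hW
      (PowerSeries.degree_trunc_lt _ _) (PowerSeries.X_pow_dvd_iff.2 fun v hv => ?_)⟩
  · have hMi : M.coeff (p + i) = 0 :=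
      coeff_eq_zero_of_degree_lt (hM.trans_le (by exact_mod_cast p.le_add_right i))
    simpa [hMi] using PowerSeries.X_pow_dvd_iff.1 hdvd (p + i) (by omega)
  · rw [map_sub, Polynomial.coeff_coe, PowerSeries.coeff_trunc]
    split_ifs with hvp
    · exact sub_self _
    · obtain ⟨i, rfl⟩ := Nat.exists_eq_add_of_le (not_lt.1 hvp)
      rw [hcoeff i (by omega), sub_zero]

/-- `(N, D)` solves the linearised `[p/q]` Padé problem for `∑ a_v z^v`: the series
`D · ∑ a_v z^v - N` vanishes to order `p + q + 1`. Only `D(0) ≠ 0` is required, not `D(0) = 1`. -/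
structure IsPadeForm (p q : ℕ) (a : ℕ → ℂ) (N D : ℂ[X]) : Prop where
  natDegree_num_le : N.natDegree ≤ p
  natDegree_denom_le : D.natDegree ≤ q
  coeff_zero_ne_zero : D.coeff 0 ≠ 0
  X_pow_dvd : PowerSeries.X ^ (p + q + 1) ∣
    (D : PowerSeries ℂ) * PowerSeries.mk a - (N : PowerSeries ℂ)

theorem isUnit_coe_of_coeff_zero_ne_zero {K : Type*} [Field K] {D : K[X]} (h : D.coeff 0 ≠ 0) :
    IsUnit (D : PowerSeries K) :=
  PowerSeries.isUnit_iff_constantCoeff.2 (by simpa using h)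

namespace IsPadeForm

variable {p q : ℕ} {a : ℕ → ℂ} {N D : ℂ[X]}

theorem denom_ne_zero (h : IsPadeForm p q a N D) : D ≠ 0 := by
  rintro rfl
  exact h.coeff_zero_ne_zero (coeff_zero 0)

theorem C_mul (h : IsPadeForm p q a N D) {c : ℂ} (hc : c ≠ 0) :
    IsPadeForm p q a (C c * N) (C c * D) where
  natDegree_num_le := (natDegree_C_mul_le _ _).trans h.natDegree_num_le
  natDegree_denom_le := (natDegree_C_mul_le _ _).trans h.natDegree_denom_le
  coeff_zero_ne_zero := by simpa [hc] using h.coeff_zero_ne_zero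
  X_pow_dvd := by
    simpa only [coe_mul, mul_assoc, ← mul_sub] using h.X_pow_dvd.mul_left (C c : PowerSeries ℂ)

theorem isPade (h : IsPadeForm p q a N D) (h1 : D.coeff 0 = 1) :
    IsPade p q a (algebraMap ℂ[X] (RatFunc ℂ) N / algebraMap ℂ[X] (RatFunc ℂ) D) := by
  refine ⟨N, D, h.natDegree_num_le, h.natDegree_denom_le, h1, rfl, fun v hv => ?_⟩
  have hinv : (D : PowerSeries ℂ)⁻¹ * D = 1 :=
    PowerSeries.inv_mul_cancel _ (by simp [h1])
  have hdvd : PowerSeries.X ^ (p + q + 1) ∣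
      PowerSeries.mk a - (N : PowerSeries ℂ) * (D : PowerSeries ℂ)⁻¹ := by
    convert h.X_pow_dvd.mul_left (D : PowerSeries ℂ)⁻¹ using 1
    rw [mul_sub, ← mul_assoc, hinv, one_mul, mul_comm (D : PowerSeries ℂ)⁻¹]
  have hcoeff := PowerSeries.X_pow_dvd_iff.1 hdvd v (by omega)
  rw [map_sub, PowerSeries.coeff_mk] at hcoeff
  exact (sub_eq_zero.1 hcoeff).symm

theorem pade_eq (h : IsPadeForm p q a N D) :
    pade p q a = algebraMap ℂ[X] (RatFunc ℂ) N / algebraMap ℂ[X] (RatFunc ℂ) D := by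
  have hc : (D.coeff 0)⁻¹ ≠ 0 := inv_ne_zero h.coeff_zero_ne_zero
  have hpade := (h.C_mul hc).isPade (by simp [h.coeff_zero_ne_zero])
  rw [map_mul, map_mul, mul_div_mul_left _ _ (by simpa using h.coeff_zero_ne_zero)] at hpade
  have hex : ∃ R, IsPade p q a R := ⟨_, hpade⟩
  rw [pade, dif_pos hex]
  exact hex.choose_spec.unique hpade

theorem isCoprime_of_inD (h : IsPadeForm p q a N D) (hD : InD p q a) : IsCoprime N D := by
  rw [← EuclideanDomain.gcd_isUnit_iff]
  obtain ⟨N', hN'⟩ := EuclideanDomain.gcd_dvd_left N D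
  obtain ⟨D', hD'⟩ := EuclideanDomain.gcd_dvd_right N D
  generalize EuclideanDomain.gcd N D = E at hN' hD'
  subst hN' hD'
  by_contra hE
  have hE0 : E ≠ 0 := left_ne_zero_of_mul h.denom_ne_zero
  have hdeg {Q : ℂ[X]} {n : ℕ} (hQ : (E * Q).natDegree ≤ n) : Q.degree < n := by
    rcases eq_or_ne Q 0 with rfl | hQ0
    · simp
    have hEdeg : E.natDegree ≠ 0 := fun h0 => hE (isUnit_iff_degree_eq_zero.2
      (by rw [degree_eq_natDegree hE0, h0, Nat.cast_zero]))
    rw [natDegree_mul hE0 hQ0] at hQ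
    rw [degree_eq_natDegree hQ0]
    exact_mod_cast (by omega : Q.natDegree < n)
  have hEunit : IsUnit (E : PowerSeries ℂ) := isUnit_coe_of_coeff_zero_ne_zero
    (left_ne_zero_of_mul (mul_coeff_zero E D' ▸ h.coeff_zero_ne_zero))
  have hdvd := h.X_pow_dvd
  rw [coe_mul, coe_mul, mul_assoc, ← mul_sub, hEunit.dvd_mul_left] at hdvd
  exact right_ne_zero_of_mul h.denom_ne_zero (inD_iff_forall_X_pow_dvd.1 hD D' N'
    (hdeg h.natDegree_denom_le) (hdeg h.natDegree_num_le) ((pow_dvd_pow _ (by omega)).trans hdvd))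

theorem inD_of_isCoprime (h : IsPadeForm p q a N D) (hco : IsCoprime N D) (hN : N.degree = p) :
    InD p q a := by
  refine inD_iff_forall_X_pow_dvd.2 fun W M hW hM hdvd => ?_
  have hcross : W * N - D * M = 0 := by
    refine eq_zero_of_X_pow_dvd_coe (n := p + q) ?_ ?_
    · refine (degree_sub_le _ _).trans_lt (max_lt ?_ ?_) <;> rw [degree_mul, Nat.cast_add]
      · rw [hN, add_comm]
        exact WithBot.add_lt_add_left (WithBot.natCast_ne_bot p) hW
      · rw [add_comm]
        exact WithBot.add_lt_add_of_lt_of_le (degree_ne_bot.2 h.denom_ne_zero) hM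
          (natDegree_le_iff_degree_le.1 h.natDegree_denom_le)
    · convert (hdvd.mul_left (D : PowerSeries ℂ)).sub
        (((pow_dvd_pow _ (Nat.le_succ _)).trans h.X_pow_dvd).mul_left (W : PowerSeries ℂ)) using 1
      push_cast
      ring
  obtain ⟨E, rfl⟩ : D ∣ W := hco.symm.dvd_of_dvd_mul_right ⟨M, sub_eq_zero.1 hcross⟩
  rw [mul_assoc, ← mul_sub, mul_eq_zero_iff_left h.denom_ne_zero, sub_eq_zero] at hcross
  by_contra hne
  have hE0 : 0 ≤ E.degree := zero_le_degree_iff.2 (right_ne_zero_of_mul hne)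
  rw [← hcross, degree_mul, hN] at hM
  exact hM.not_ge (le_add_of_nonneg_left hE0)

end IsPadeForm

/-- The Padé denominator by Cramer's rule, multiplied by the Hankel determinant to make it a
polynomial expression in the coefficients. -/
noncomputable def padeDenom (p q : ℕ) (a : ℕ → ℂ) : ℂ[X] :=
  C (hankel p q a).det -
    X * ofFn q (Matrix.cramer (hankel p q a) (fun i : Fin q => a (p + 1 + i)) ∘ Fin.rev)

/-- The Padé numerator matching `padeDenom`. -/
noncomputable def padeNum (p q : ℕ) (a : ℕ → ℂ) : ℂ[X] :=
  PowerSeries.trunc (p + 1) ((padeDenom p q a : PowerSeries ℂ) * PowerSeries.mk a)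

theorem natDegree_padeDenom_le (p q : ℕ) (a : ℕ → ℂ) : (padeDenom p q a).natDegree ≤ q := by
  refine natDegree_le_iff_coeff_eq_zero.2 fun n hn => ?_
  obtain ⟨m, rfl⟩ := Nat.exists_eq_succ_of_ne_zero (Nat.ne_zero_of_lt hn)
  rw [padeDenom, coeff_sub, coeff_X_mul, ofFn_coeff_eq_zero_of_ge _ (by omega), coeff_C_succ,
    sub_zero]

theorem coeff_zero_padeDenom (p q : ℕ) (a : ℕ → ℂ) :
    (padeDenom p q a).coeff 0 = (hankel p q a).det := by
  simp [padeDenom]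

theorem coeff_padeDenom_mul_mk (p : ℕ) {q : ℕ} (a : ℕ → ℂ) (i : Fin q) :
    PowerSeries.coeff (p + i + 1) ((padeDenom p q a : PowerSeries ℂ) * PowerSeries.mk a) = 0 := by
  rw [padeDenom, coe_sub, coe_mul, coe_C, coe_X, sub_mul, map_sub, PowerSeries.coeff_C_mul,
    PowerSeries.coeff_mk, mul_assoc, PowerSeries.coeff_succ_X_mul, coeff_ofFn_rev_mul_mk,
    Matrix.mulVec_cramer, Pi.smul_apply, smul_eq_mul, add_right_comm, sub_self]

theorem InD.isPadeForm {p q : ℕ} {a : ℕ → ℂ} (h : InD p q a) :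
    IsPadeForm p q a (padeNum p q a) (padeDenom p q a) where
  natDegree_num_le := Nat.lt_succ_iff.1 (PowerSeries.natDegree_trunc_lt _ _)
  natDegree_denom_le := natDegree_padeDenom_le p q a
  coeff_zero_ne_zero := by rwa [coeff_zero_padeDenom]
  X_pow_dvd := by
    refine PowerSeries.X_pow_dvd_iff.2 fun v hv => ?_
    rw [map_sub, Polynomial.coeff_coe, padeNum, PowerSeries.coeff_trunc]
    split_ifs with hvp
    · exact sub_self _
    · obtain ⟨i, rfl⟩ := Nat.exists_eq_add_of_le (not_lt.1 hvp)
      rw [add_right_comm, coeff_padeDenom_mul_mk p a ⟨i, by omega⟩, sub_zero]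

/-! ### Rational functions -/

section RationalFunctions

variable {K : Type*} [Field K]

theorem ratFunc_eval_div (N : K[X]) {D : K[X]} {z : K} (hz : D.eval z ≠ 0) :
    (algebraMap K[X] (RatFunc K) N / algebraMap K[X] (RatFunc K) D).eval (RingHom.id K) z =
      N.eval z / D.eval z := by
  set R := algebraMap K[X] (RatFunc K) N / algebraMap K[X] (RatFunc K) D with hR
  have hD : D ≠ 0 := by rintro rfl; exact hz eval_zero
  have hcross : R.num * D = N * R.denom := (RatFunc.num_mul_eq_mul_denom_iff hD).2 hR
  have hR0 : R.denom.eval z ≠ 0 := fun h0 =>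
    hz (eval_eq_zero_of_dvd_of_eval_eq_zero (RatFunc.denom_div_dvd N D) h0)
  rw [RatFunc.eval, eval₂_id, eval₂_id, div_eq_div_iff hR0 hz, ← eval_mul, hcross, eval_mul]

theorem ratFunc_denom_add_algebraMap (R : RatFunc K) (P : K[X]) :
    (R + algebraMap K[X] (RatFunc K) P).denom = R.denom := by
  have hdvd : ∀ (S : RatFunc K) (Q : K[X]),
      (S + algebraMap K[X] (RatFunc K) Q).denom ∣ S.denom := fun S Q => by
    simpa only [RatFunc.denom_algebraMap, mul_one] using
      RatFunc.denom_add_dvd S (algebraMap K[X] (RatFunc K) Q)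
  refine eq_of_monic_of_associated (RatFunc.monic_denom _) (RatFunc.monic_denom _)
    (associated_of_dvd_dvd (hdvd R P) ?_)
  simpa only [map_neg, add_neg_cancel_right] using
    hdvd (R + algebraMap K[X] (RatFunc K) P) (-P)

theorem ratFunc_num_add_algebraMap (R : RatFunc K) (P : K[X]) :
    (R + algebraMap K[X] (RatFunc K) P).num = R.num + P * R.denom := by
  have h := RatFunc.num_denom_add R (algebraMap K[X] (RatFunc K) P)
  rw [RatFunc.denom_algebraMap, RatFunc.num_algebraMap, mul_one, mul_one,
    ratFunc_denom_add_algebraMap] at h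
  rw [mul_right_cancel₀ R.denom_ne_zero h, mul_comm P]

end RationalFunctions

section NoPolesIn

variable {N D : ℂ[X]} {R S : RatFunc ℂ} {K : Set ℂ}

theorem noPolesIn_div (hD : ∀ z ∈ K, D.eval z ≠ 0) :
    NoPolesIn (algebraMap ℂ[X] (RatFunc ℂ) N / algebraMap ℂ[X] (RatFunc ℂ) D) K := fun z hz h =>
  hD z hz (eval_eq_zero_of_dvd_of_eval_eq_zero (RatFunc.denom_div_dvd N D) h)

theorem noPolesIn_div_iff (hND : IsCoprime N D) (hD : D ≠ 0) :
    NoPolesIn (algebraMap ℂ[X] (RatFunc ℂ) N / algebraMap ℂ[X] (RatFunc ℂ) D) K ↔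
      ∀ z ∈ K, D.eval z ≠ 0 := by
  refine ⟨fun h z hz hDz => h z hz (eval_eq_zero_of_dvd_of_eval_eq_zero ?_ hDz), noPolesIn_div⟩
  refine hND.symm.dvd_of_dvd_mul_left ?_
  rw [← (RatFunc.num_mul_eq_mul_denom_iff hD).2 rfl]
  exact dvd_mul_left D _

theorem noPolesIn_algebraMap (P : ℂ[X]) (K : Set ℂ) :
    NoPolesIn (algebraMap ℂ[X] (RatFunc ℂ) P) K := fun z _ => by
  rw [RatFunc.denom_algebraMap, eval_one]
  exact one_ne_zero

namespace NoPolesIn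

theorem mono {L : Set ℂ} (hR : NoPolesIn R K) (h : L ⊆ K) : NoPolesIn R L :=
  fun z hz => hR z (h hz)

theorem add (hR : NoPolesIn R K) (hS : NoPolesIn S K) : NoPolesIn (R + S) K := fun z hz h =>
  mul_ne_zero (hR z hz) (hS z hz) <| by
    rw [← eval_mul]
    exact eval_eq_zero_of_dvd_of_eval_eq_zero (RatFunc.denom_add_dvd R S) h

theorem mul (hR : NoPolesIn R K) (hS : NoPolesIn S K) : NoPolesIn (R * S) K := fun z hz h =>
  mul_ne_zero (hR z hz) (hS z hz) <| by
    rw [← eval_mul]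
    exact eval_eq_zero_of_dvd_of_eval_eq_zero (RatFunc.denom_mul_dvd R S) h

theorem eval_add (hR : NoPolesIn R K) (hS : NoPolesIn S K) {z : ℂ} (hz : z ∈ K) :
    (R + S).eval (RingHom.id ℂ) z = R.eval (RingHom.id ℂ) z + S.eval (RingHom.id ℂ) z :=
  RatFunc.eval_add (RingHom.id ℂ) z (eval₂_id.trans_ne (hR z hz)) (eval₂_id.trans_ne (hS z hz))

theorem eval_mul (hR : NoPolesIn R K) (hS : NoPolesIn S K) {z : ℂ} (hz : z ∈ K) :
    (R * S).eval (RingHom.id ℂ) z = R.eval (RingHom.id ℂ) z * S.eval (RingHom.id ℂ) z :=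
  RatFunc.eval_mul (RingHom.id ℂ) z (eval₂_id.trans_ne (hR z hz)) (eval₂_id.trans_ne (hS z hz))

theorem differentiableOn (hR : NoPolesIn R K) :
    DifferentiableOn ℂ (fun z => R.eval (RingHom.id ℂ) z) K := by
  simp only [RatFunc.eval, eval₂_id]
  exact R.num.differentiable.differentiableOn.div R.denom.differentiable.differentiableOn hR

end NoPolesIn

theorem isOpen_eval_ne_zero (D : ℂ[X]) : IsOpen {z : ℂ | D.eval z ≠ 0} :=
  isOpen_ne_fun D.continuous continuous_const

theorem NoPolesIn.contDiffAt {z : ℂ} (hR : NoPolesIn R K) (hz : z ∈ K) (n : WithTop ℕ∞) :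
    ContDiffAt ℂ n (fun z => R.eval (RingHom.id ℂ) z) z :=
  (NoPolesIn.differentiableOn (K := {z | R.denom.eval z ≠ 0}) fun _ => id).contDiffOn
    (isOpen_eval_ne_zero _) |>.contDiffAt ((isOpen_eval_ne_zero _).mem_nhds (hR z hz))

theorem NoPolesIn.continuousOn_ratDeriv (hR : NoPolesIn R K) (l : ℕ) :
    ContinuousOn (ratDeriv l R) K :=
  (differentiableOn_iteratedDeriv (NoPolesIn.differentiableOn fun _ => id)
    (isOpen_eval_ne_zero R.denom) l).continuousOn.mono hR

end NoPolesIn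

section DerivativesOfQuotients

/-- The numerators of the derivatives of `N / D`: the `l`-th one is that over `D ^ (l + 1)`. -/
noncomputable def derivNum {R : Type*} [CommRing R] (N D : R[X]) : ℕ → R[X]
  | 0 => N
  | l + 1 => derivative (derivNum N D l) * D - C ((l : R) + 1) * derivNum N D l * derivative D

variable {𝕜 : Type*} [NontriviallyNormedField 𝕜]

theorem iteratedDeriv_eval_div (N D : 𝕜[X]) (l : ℕ) :
    EqOn (iteratedDeriv l fun z => N.eval z / D.eval z)
      (fun z => (derivNum N D l).eval z / D.eval z ^ (l + 1)) {z | D.eval z ≠ 0} := by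
  induction l with
  | zero => intro z _; simp [derivNum]
  | succ l ih =>
    intro z (hz : D.eval z ≠ 0)
    have hopen : IsOpen {z : 𝕜 | D.eval z ≠ 0} := isOpen_ne_fun D.continuous continuous_const
    have hderiv := ((derivNum N D l).hasDerivAt z).fun_div ((D.hasDerivAt z).fun_pow (l + 1))
      (pow_ne_zero _ hz)
    rw [iteratedDeriv_succ, (ih.eventuallyEq_of_mem (hopen.mem_nhds hz)).deriv_eq, hderiv.deriv]
    simp only [derivNum, eval_sub, eval_mul, eval_C]
    push_cast
    rw [div_eq_div_iff (by positivity) (by positivity)]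
    ring

theorem ratDeriv_div (N D : ℂ[X]) (l : ℕ) :
    EqOn (ratDeriv l (algebraMap ℂ[X] (RatFunc ℂ) N / algebraMap ℂ[X] (RatFunc ℂ) D))
      (fun z => (derivNum N D l).eval z / D.eval z ^ (l + 1)) {z | D.eval z ≠ 0} :=
  (EqOn.iteratedDeriv_of_isOpen (fun _ hz => ratFunc_eval_div N hz) (isOpen_eval_ne_zero D) l).trans
    (iteratedDeriv_eval_div N D l)

end DerivativesOfQuotients

section TaylorSeries

variable {𝕜 : Type*} [NontriviallyNormedField 𝕜]

/-- The formal Taylor series of `f` at `0`. -/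
noncomputable def taylorSeries (f : 𝕜 → 𝕜) : PowerSeries 𝕜 :=
  PowerSeries.mk fun n => iteratedDeriv n f 0 / (n.factorial : 𝕜)

theorem taylorSeries_congr {f g : 𝕜 → 𝕜} (h : f =ᶠ[𝓝 0] g) : taylorSeries f = taylorSeries g := by
  ext n
  simp only [taylorSeries, PowerSeries.coeff_mk, h.iteratedDeriv_eq n]

theorem iteratedDeriv_eval (P : 𝕜[X]) (n : ℕ) (z : 𝕜) :
    iteratedDeriv n (fun z => P.eval z) z = (derivative^[n] P).eval z := by
  induction n generalizing z with
  | zero => rw [iteratedDeriv_zero, Function.iterate_zero_apply]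
  | succ n ih =>
    rw [iteratedDeriv_succ, funext ih, Function.iterate_succ_apply', Polynomial.deriv]

variable [CharZero 𝕜]

theorem taylorSeries_eval (P : 𝕜[X]) : taylorSeries (fun z => P.eval z) = P := by
  ext n
  have hn : (n.factorial : 𝕜) ≠ 0 := by exact_mod_cast n.factorial_ne_zero
  rw [taylorSeries, PowerSeries.coeff_mk, iteratedDeriv_eval, ← coeff_zero_eq_eval_zero,
    coeff_iterate_derivative, zero_add, Nat.descFactorial_self, nsmul_eq_mul,
    mul_div_cancel_left₀ _ hn, Polynomial.coeff_coe]

theorem taylorSeries_mul {f g : 𝕜 → 𝕜} (hf : ∀ n : ℕ, ContDiffAt 𝕜 n f 0)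
    (hg : ∀ n : ℕ, ContDiffAt 𝕜 n g 0) :
    taylorSeries (fun z => f z * g z) = taylorSeries f * taylorSeries g := by
  ext n
  simp only [taylorSeries, PowerSeries.coeff_mul, PowerSeries.coeff_mk,
    iteratedDeriv_fun_mul (hf n) (hg n), Finset.sum_div,
    Finset.Nat.sum_antidiagonal_eq_sum_range_succ_mk]
  refine Finset.sum_congr rfl fun i hi => ?_
  have hfact : ∀ k : ℕ, (k.factorial : 𝕜) ≠ 0 := fun k => by exact_mod_cast k.factorial_ne_zero
  have := hfact i
  have := hfact (n - i)
  have := hfact n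
  rw [Nat.cast_choose 𝕜 (Nat.lt_succ_iff.1 (Finset.mem_range.1 hi))]
  field_simp

end TaylorSeries

theorem denom_mul_taylorSeries_ratFunc {R : RatFunc ℂ} (h0 : R.denom.eval 0 ≠ 0) :
    (R.denom : PowerSeries ℂ) * taylorSeries (fun z => R.eval (RingHom.id ℂ) z) = R.num := by
  have hR : NoPolesIn R {0} := by rintro z rfl; exact h0
  have hmul : (fun z => R.denom.eval z * R.eval (RingHom.id ℂ) z) =ᶠ[𝓝 0]
      fun z => R.num.eval z := by
    filter_upwards [(isOpen_eval_ne_zero R.denom).mem_nhds h0] with z hz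
    rw [RatFunc.eval, eval₂_id, eval₂_id, mul_div_cancel₀ _ hz]
  have hdenom : ∀ n : ℕ, ContDiffAt ℂ n (fun z => R.denom.eval z) 0 := fun _ =>
    R.denom.differentiable.contDiff.contDiffAt
  rw [← taylorSeries_eval R.denom, ← taylorSeries_mul hdenom fun n => hR.contDiffAt rfl n,
    taylorSeries_congr hmul, taylorSeries_eval]

namespace AInfty

variable {Ω : Set ℂ} {R : RatFunc ℂ}

/-- The element of `A^∞(Ω)` given by a rational function without poles in the closure of `Ω`. -/
noncomputable def ofRat (hΩ : IsOpen Ω) (R : RatFunc ℂ) (hR : NoPolesIn R (closure Ω)) : AInfty Ω :=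
  ofFun hΩ (fun z => R.eval (RingHom.id ℂ) z) (hR.mono subset_closure).differentiableOn
    fun l => ⟨ratDeriv l R, hR.continuousOn_ratDeriv l, fun _ _ => rfl⟩

theorem bar_ofRat (hΩ : IsOpen Ω) (hR : NoPolesIn R (closure Ω)) (l : ℕ) :
    EqOn ((ofRat hΩ R hR).bar l) (ratDeriv l R) (closure Ω) :=
  bar_eqOn_closure hΩ (fun _ => rfl) (hR.continuousOn_ratDeriv l) fun _ _ => rfl

theorem ofRat_mem_holoClosure (hΩ : IsOpen Ω) (hR : NoPolesIn R (closure Ω)) :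
    ofRat hΩ R hR ∈ holoClosure Ω :=
  ⟨{z | R.denom.eval z ≠ 0}, _, isOpen_eval_ne_zero _, hR,
    NoPolesIn.differentiableOn fun _ => id, fun _ => rfl⟩

theorem mk_taylor (hΩ : IsOpen Ω) (h0 : (0 : ℂ) ∈ Ω) {f : AInfty Ω} {h : ℂ → ℂ}
    (hf : ∀ z : Ω, f.toFun z = h z) : PowerSeries.mk f.taylor = taylorSeries h := by
  ext n
  rw [PowerSeries.coeff_mk, taylor, derivOn_eqOn hΩ hf n h0, taylorSeries, PowerSeries.coeff_mk]

theorem denom_mul_taylor_ofRat (hΩ : IsOpen Ω) (h0 : (0 : ℂ) ∈ Ω)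
    (hR : NoPolesIn R (closure Ω)) :
    (R.denom : PowerSeries ℂ) * PowerSeries.mk (ofRat hΩ R hR).taylor = R.num := by
  rw [mk_taylor hΩ h0 (h := fun z => R.eval (RingHom.id ℂ) z) fun _ => rfl,
    denom_mul_taylorSeries_ratFunc (hR 0 (subset_closure h0))]

end AInfty

/-! ### Functions close to one of their Padé approximants -/

/-- A family of polynomials of bounded degree whose coefficients depend continuously on the
parameter, so that its values depend jointly continuously on the parameter and the point. -/
def ContinuousFamily {R T : Type*} [Semiring R] [TopologicalSpace R] [TopologicalSpace T]
    (P : T → R[X]) : Prop :=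
  ∃ d : ℕ, (∀ t, (P t).natDegree ≤ d) ∧ ∀ i, Continuous fun t => (P t).coeff i

namespace ContinuousFamily

variable {T : Type*} [TopologicalSpace T]

theorem const {R : Type*} [Semiring R] [TopologicalSpace R] (p : R[X]) :
    ContinuousFamily fun _ : T => p :=
  ⟨p.natDegree, fun _ => le_rfl, fun _ => continuous_const⟩

section Ring

variable {R : Type*} [CommRing R] [TopologicalSpace R] [IsTopologicalRing R] {P Q : T → R[X]}

theorem continuous_eval (hP : ContinuousFamily P) :
    Continuous fun x : T × R => (P x.1).eval x.2 := by
  obtain ⟨d, hd, hc⟩ := hP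
  simp_rw [fun x : T × R => eval_eq_sum_range' (Nat.lt_succ_iff.2 (hd x.1)) x.2]
  exact continuous_finsetSum _ fun i _ =>
    ((hc i).comp continuous_fst).mul (continuous_snd.pow i)

theorem sub (hP : ContinuousFamily P) (hQ : ContinuousFamily Q) :
    ContinuousFamily fun t => P t - Q t := by
  obtain ⟨d, hd, hc⟩ := hP
  obtain ⟨e, he, hc'⟩ := hQ
  refine ⟨max d e, fun t => (natDegree_sub_le _ _).trans (max_le_max (hd t) (he t)), fun i => ?_⟩
  simp only [coeff_sub]
  exact (hc i).sub (hc' i)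

theorem mul (hP : ContinuousFamily P) (hQ : ContinuousFamily Q) :
    ContinuousFamily fun t => P t * Q t := by
  obtain ⟨d, hd, hc⟩ := hP
  obtain ⟨e, he, hc'⟩ := hQ
  refine ⟨d + e, fun t => natDegree_mul_le.trans (add_le_add (hd t) (he t)), fun i => ?_⟩
  simp only [coeff_mul]
  exact continuous_finsetSum _ fun x _ => (hc x.1).mul (hc' x.2)

theorem derivative (hP : ContinuousFamily P) :
    ContinuousFamily fun t => Polynomial.derivative (P t) := by
  obtain ⟨d, hd, hc⟩ := hP
  refine ⟨d, fun t => (natDegree_derivative_le _).trans ((Nat.sub_le _ _).trans (hd t)),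
    fun i => ?_⟩
  simp only [coeff_derivative]
  exact (hc (i + 1)).mul continuous_const

theorem derivNum (hP : ContinuousFamily P) (hQ : ContinuousFamily Q) (l : ℕ) :
    ContinuousFamily fun t => derivNum (P t) (Q t) l := by
  induction l with
  | zero => exact hP
  | succ l ih => exact (ih.derivative.mul hQ).sub (((const _).mul ih).mul hQ.derivative)

end Ring

variable {a : T → ℕ → ℂ}

theorem continuous_hankel (ha : ∀ v, Continuous fun t => a t v) (p q : ℕ) :
    Continuous fun t => hankel p q (a t) := by
  refine continuous_matrix fun i j => ?_
  simp only [hankel, Matrix.of_apply, coeffZ]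
  split_ifs
  · exact ha _
  · exact continuous_const

theorem padeDenom (ha : ∀ v, Continuous fun t => a t v) (p q : ℕ) :
    ContinuousFamily fun t => padeDenom p q (a t) := by
  refine ⟨q, fun t => natDegree_padeDenom_le p q (a t), fun i => ?_⟩
  have hH := continuous_hankel ha p q
  cases i with
  | zero => simpa only [coeff_zero_padeDenom] using hH.matrix_det
  | succ i =>
    simp only [_root_.padeDenom, coeff_sub, coeff_C_succ, coeff_X_mul, zero_sub]
    by_cases hi : i < q
    · simp only [ofFn_coeff_eq_val_of_lt _ hi]
      exact ((continuous_apply _).comp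
        (hH.matrix_cramer (continuous_pi fun j : Fin q => ha (p + 1 + j)))).neg
    · simp only [ofFn_coeff_eq_zero_of_ge _ (not_lt.1 hi)]
      exact continuous_const

theorem padeNum (ha : ∀ v, Continuous fun t => a t v) (p q : ℕ) :
    ContinuousFamily fun t => padeNum p q (a t) := by
  refine ⟨p, fun t => Nat.lt_succ_iff.1 (PowerSeries.natDegree_trunc_lt _ _), fun i => ?_⟩
  obtain ⟨-, -, hc⟩ := padeDenom ha p q
  simp only [_root_.padeNum, PowerSeries.coeff_trunc]
  split_ifs
  · simp only [PowerSeries.coeff_mul, Polynomial.coeff_coe, PowerSeries.coeff_mk]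
    exact continuous_finsetSum _ fun x _ => (hc x.1).mul (ha x.2)
  · exact continuous_const

end ContinuousFamily

theorem InD.noPolesIn_pade_iff {p q : ℕ} {a : ℕ → ℂ} (h : InD p q a) (K : Set ℂ) :
    NoPolesIn (pade p q a) K ↔ ∀ z ∈ K, (padeDenom p q a).eval z ≠ 0 := by
  rw [h.isPadeForm.pade_eq,
    noPolesIn_div_iff (h.isPadeForm.isCoprime_of_inD h) h.isPadeForm.denom_ne_zero]

theorem isOpen_setOf_forall_of_isOpen {X Y : Type*} [TopologicalSpace X] [TopologicalSpace Y]
    [CompactSpace Y] {P : X → Y → Prop} (hP : IsOpen {x : X × Y | P x.1 x.2}) :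
    IsOpen {x | ∀ y, P x y} := by
  refine isOpen_iff_eventually.2 fun x hx => ?_
  filter_upwards [isCompact_univ.eventually_forall_of_forall_eventually
    fun y _ => hP.eventually_mem (hx y)] with x' hx' y
  exact hx' y (mem_univ y)

section PadeGood

variable {Ω : Set ℂ}

/-- The functions whose `[p/q]` Padé approximant exists and is within `1 / (s + 1)` of `f` with all
derivatives up to order `s`, on the part of the closure of `Ω` in the disc of radius `s`. -/
def padeGood (Ω : Set ℂ) (p q s : ℕ) : Set (AInfty Ω) :=
  {f | InD p q f.taylor ∧
    NoPolesIn (pade p q f.taylor) (closure Ω ∩ Metric.closedBall (0 : ℂ) (s : ℝ)) ∧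
    ∀ l ≤ s, ∀ z ∈ closure Ω ∩ Metric.closedBall (0 : ℂ) (s : ℝ),
      ‖ratDeriv l (pade p q f.taylor) z - f.bar l z‖ < 1 / ((s : ℝ) + 1)}

theorem InD.norm_ratDeriv_pade_sub_lt_iff {p q l : ℕ} {a : ℕ → ℂ} (h : InD p q a) {z b : ℂ}
    (hz : (padeDenom p q a).eval z ≠ 0) {ε : ℝ} :
    ‖ratDeriv l (pade p q a) z - b‖ < ε ↔
      ‖(derivNum (padeNum p q a) (padeDenom p q a) l).eval z -
        b * (padeDenom p q a).eval z ^ (l + 1)‖ < ε * ‖(padeDenom p q a).eval z‖ ^ (l + 1) := by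
  have hpow : (padeDenom p q a).eval z ^ (l + 1) ≠ 0 := pow_ne_zero _ hz
  rw [h.isPadeForm.pade_eq, ratDeriv_div _ _ l hz, div_sub' hpow, norm_div, norm_pow,
    div_lt_iff₀ (by positivity), mul_comm b]

-- Clearing denominators exhibits `padeGood` through strict inequalities between jointly continuous
-- functions; the inequality with `l = 0` already excludes poles.
theorem mem_padeGood_iff {p q s : ℕ} {f : AInfty Ω} : f ∈ padeGood Ω p q s ↔
    (hankel p q f.taylor).det ≠ 0 ∧
    ∀ z : ↥(closure Ω ∩ Metric.closedBall (0 : ℂ) (s : ℝ)), ∀ l ∈ Iic s,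
      ‖(derivNum (padeNum p q f.taylor) (padeDenom p q f.taylor) l).eval (z : ℂ) -
        f.bar l z * (padeDenom p q f.taylor).eval (z : ℂ) ^ (l + 1)‖ <
        1 / ((s : ℝ) + 1) * ‖(padeDenom p q f.taylor).eval (z : ℂ)‖ ^ (l + 1) := by
  refine and_congr_right fun h => ?_
  rw [InD.noPolesIn_pade_iff h]
  constructor
  · rintro ⟨hpole, hclose⟩ z l hl
    exact (InD.norm_ratDeriv_pade_sub_lt_iff h (hpole z z.2)).1 (hclose l hl z z.2)
  · intro H
    have hpole : ∀ z ∈ closure Ω ∩ Metric.closedBall (0 : ℂ) (s : ℝ),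
        (padeDenom p q f.taylor).eval z ≠ 0 := fun z hz h0 => by
      have hpos := (norm_nonneg _).trans_lt (H ⟨z, hz⟩ 0 (Nat.zero_le s))
      simp [h0] at hpos
    exact ⟨hpole, fun l hl z hz =>
      (InD.norm_ratDeriv_pade_sub_lt_iff h (hpole z hz)).2 (H ⟨z, hz⟩ l hl)⟩

theorem isOpen_padeGood (h0 : (0 : ℂ) ∈ Ω) (p q s : ℕ) : IsOpen (padeGood Ω p q s) := by
  have ha : ∀ v, Continuous fun f : AInfty Ω => f.taylor v := AInfty.continuous_taylor h0
  have hDen := ContinuousFamily.padeDenom ha p q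
  have hNum := ContinuousFamily.padeNum ha p q
  have : CompactSpace ↥(closure Ω ∩ Metric.closedBall (0 : ℂ) (s : ℝ)) :=
    isCompact_iff_compactSpace.1 ((isCompact_closedBall _ _).inter_left isClosed_closure)
  have hval : Continuous fun x : AInfty Ω × ↥(closure Ω ∩ Metric.closedBall (0 : ℂ) (s : ℝ)) =>
      (x.1, (x.2 : ℂ)) := by fun_prop
  have hdet := (ContinuousFamily.continuous_hankel ha p q).matrix_det
  change IsOpen {f | f ∈ padeGood Ω p q s}
  simp only [mem_padeGood_iff]
  refine (isOpen_ne_fun hdet continuous_const).and (isOpen_setOf_forall_of_isOpen ?_)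
  simp only [ofPred_forall]
  refine (finite_Iic s).isOpen_biInter fun l _ => isOpen_lt ?_ ?_
  · exact (((hNum.derivNum hDen l).continuous_eval.comp hval).sub
      ((AInfty.continuous_bar_uncurry l s).mul ((hDen.continuous_eval.comp hval).pow _))).norm
  · exact continuous_const.mul ((hDen.continuous_eval.comp hval).norm.pow _)

theorem bSet_subset_iInter_padeGood (F : Set (ℕ × ℕ)) :
    BSet Ω F ⊆ ⋂ s : ℕ, ⋃ u ∈ F, padeGood Ω u.1 u.2 s := by
  rintro f ⟨u, huF, huD, hu⟩
  refine mem_iInter.2 fun s => ?_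
  obtain ⟨hpole, hconv⟩ := hu (closure Ω ∩ Metric.closedBall (0 : ℂ) (s : ℝ)) inter_subset_left
    ((isCompact_closedBall _ _).inter_left isClosed_closure)
  have hclose : ∀ᶠ m in atTop, ∀ l ∈ Iic s, ∀ z ∈ closure Ω ∩ Metric.closedBall (0 : ℂ) (s : ℝ),
      ‖ratDeriv l (pade (u m).1 (u m).2 f.taylor) z - f.bar l z‖ < 1 / ((s : ℝ) + 1) := by
    refine (eventually_all_finite (finite_Iic s)).2 fun l _ => ?_
    filter_upwards [Metric.tendstoUniformlyOn_iff.1 (hconv l) _ s.one_div_pos_of_nat] with m hm z hz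
    simpa only [dist_eq_norm'] using hm z hz
  obtain ⟨m, hm, hm'⟩ := (hpole.and hclose).exists
  exact mem_iUnion₂.2 ⟨u m, huF m, huD m, hm, hm'⟩

theorem iInter_padeGood_subset_bSet (F : Set (ℕ × ℕ)) :
    ⋂ s : ℕ, ⋃ u ∈ F, padeGood Ω u.1 u.2 s ⊆ BSet Ω F := by
  intro f hf
  simp only [mem_iInter, mem_iUnion, exists_prop] at hf
  choose u huF huD hpole hclose using hf
  refine ⟨u, huF, huD, fun K hK hKc => ?_⟩
  obtain ⟨r, hr⟩ := hKc.isBounded.subset_closedBall (0 : ℂ)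
  have hsub : ∀ᶠ m : ℕ in atTop, K ⊆ closure Ω ∩ Metric.closedBall (0 : ℂ) (m : ℝ) := by
    filter_upwards [tendsto_natCast_atTop_atTop.eventually_ge_atTop r] with m hm
    exact subset_inter hK (hr.trans (Metric.closedBall_subset_closedBall hm))
  refine ⟨hsub.mono fun m hm => (hpole m).mono hm,
    fun l => Metric.tendstoUniformlyOn_iff.2 fun ε hε => ?_⟩
  have hsmall := (tendsto_one_div_add_atTop_nhds_zero_nat (𝕜 := ℝ)).eventually_lt_const hε
  filter_upwards [hsub, eventually_ge_atTop l, hsmall] with m hm hlm hmε z hz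
  rw [dist_eq_norm']
  exact (hclose m l hlm z (hm hz)).trans hmε

theorem bSet_eq_iInter_padeGood (F : Set (ℕ × ℕ)) :
    BSet Ω F = ⋂ s : ℕ, ⋃ u ∈ F, padeGood Ω u.1 u.2 s :=
  (bSet_subset_iInter_padeGood F).antisymm (iInter_padeGood_subset_bSet F)

end PadeGood

/-! ### The Cauchy–Pompeiu formula -/

section CauchyPompeiu

open MeasureTheory

variable {E : Type*} [NormedAddCommGroup E] [NormedSpace ℂ E] {g : ℂ → E}

/-- The Wirtinger derivative `∂g/∂z̄` of a real-differentiable function. -/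
noncomputable def dbar (g : ℂ → E) (w : ℂ) : E :=
  (2 : ℂ)⁻¹ • (fderiv ℝ g w 1 + Complex.I • fderiv ℝ g w Complex.I)

theorem dbar_eq_zero_of_differentiableAt {w : ℂ} (h : DifferentiableAt ℂ g w) :
    dbar g w = 0 := by
  simp [dbar, h.fderiv_restrictScalars ℝ, smul_smul]

theorem support_dbar_subset : Function.support (dbar g) ⊆ tsupport g := by
  intro w hw
  by_contra h
  exact hw (by simp [dbar, Function.notMem_support.1 fun h' => h (support_fderiv_subset ℝ h')])

theorem continuous_dbar (hg : ContDiff ℝ 1 g) : Continuous (dbar g) := by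
  have : Continuous (fderiv ℝ g) := hg.continuous_fderiv one_ne_zero
  unfold dbar
  fun_prop

theorem conj_smul_dbar (w v : ℂ) :
    (starRingEnd ℂ v) • dbar g w =
      (2 : ℂ)⁻¹ • (fderiv ℝ g w v + Complex.I • fderiv ℝ g w (Complex.I * v)) := by
  have hD : ∀ u : ℂ, fderiv ℝ g w u =
      (u.re : ℂ) • fderiv ℝ g w 1 + (u.im : ℂ) • fderiv ℝ g w Complex.I := fun u => by
    rw [Complex.coe_smul, Complex.coe_smul, ← map_smul, ← map_smul, ← map_add]
    congr 1
    simp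
  have hconj : starRingEnd ℂ v = v.re - v.im * Complex.I := by
    apply Complex.ext <;> simp
  rw [hD v, hD (Complex.I * v), hconj, dbar]
  simp only [Complex.I_mul_re, Complex.I_mul_im, Complex.ofReal_neg]
  match_scalars
  · ring
  · linear_combination (-v.im / 2 : ℂ) * Complex.I_mul_I

/-- The point with polar coordinates `p` about the centre `z`. -/
noncomputable def polarAt (z : ℂ) (p : ℝ × ℝ) : ℂ := z + p.1 * Complex.exp (p.2 * Complex.I)

theorem dist_polarAt (z : ℂ) (p : ℝ × ℝ) : dist (polarAt z p) z = |p.1| := by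
  simp [polarAt, Complex.norm_exp_ofReal_mul_I]

theorem integrableOn_fderiv_polarAt (hg : ContDiff ℝ 1 g) (hgc : HasCompactSupport g) (z : ℂ)
    {v : ℝ → ℂ} (hv : Continuous v) :
    IntegrableOn (fun p => fderiv ℝ g (polarAt z p) (v p.2)) polarCoord.target := by
  have : Continuous (fderiv ℝ g) := hg.continuous_fderiv one_ne_zero
  obtain ⟨r, hr⟩ := (hgc.fderiv ℝ).isCompact.isBounded.subset_closedBall z
  have hcont : Continuous fun p : ℝ × ℝ => fderiv ℝ g (polarAt z p) (v p.2) := by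
    unfold polarAt
    fun_prop
  refine (hcont.continuousOn.integrableOn_compact
    (isCompact_Icc.prod isCompact_Icc : IsCompact (Icc 0 r ×ˢ Icc (-Real.pi) Real.pi)))
    |>.of_forall_sdiff_eq_zero polarCoord.open_target.measurableSet ?_
  rintro ⟨ρ, θ⟩ ⟨⟨hρ, hθ⟩, hp⟩
  have hρr : r < ρ := by
    by_contra! h
    exact hp ⟨⟨hρ.le, h⟩, Ioo_subset_Icc_self hθ⟩
  have hnotMem : polarAt z (ρ, θ) ∉ tsupport (fderiv ℝ g) := fun h => by
    have : dist (polarAt z (ρ, θ)) z ≤ r := hr h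
    simp only [dist_polarAt, abs_of_pos (show 0 < ρ from hρ)] at this
    exact this.not_gt hρr
  rw [image_eq_zero_of_notMem_tsupport hnotMem, zero_apply]

theorem hasDerivAt_polarAt_radius (z : ℂ) (ρ θ : ℝ) :
    HasDerivAt (fun ρ : ℝ => polarAt z (ρ, θ)) (Complex.exp (θ * Complex.I)) ρ := by
  simpa [polarAt] using
    ((Complex.ofRealCLM.hasDerivAt (x := ρ)).mul_const (Complex.exp (θ * Complex.I))).const_add z

theorem hasDerivAt_polarAt_angle (z : ℂ) (ρ θ : ℝ) :
    HasDerivAt (fun θ : ℝ => polarAt z (ρ, θ)) (ρ • (Complex.I * Complex.exp (θ * Complex.I)))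
      θ := by
  have := (((Complex.ofRealCLM.hasDerivAt (x := θ)).mul_const Complex.I).cexp.const_mul
    (ρ : ℂ)).const_add z
  simpa [polarAt, mul_comm] using this

theorem integral_fderiv_radial [CompleteSpace E] (hg : ContDiff ℝ 1 g) (hgc : HasCompactSupport g)
    (z : ℂ) :
    ∫ p in polarCoord.target, fderiv ℝ g (polarAt z p) (Complex.exp (p.2 * Complex.I)) =
      -(2 * Real.pi) • g z := by
  have hray : ∀ θ : ℝ, ∫ ρ in Ioi (0 : ℝ), fderiv ℝ g (polarAt z (ρ, θ))
      (Complex.exp (θ * Complex.I)) = -g z := by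
    intro θ
    have hderiv : ∀ ρ : ℝ, HasDerivAt (fun ρ : ℝ => g (polarAt z (ρ, θ)))
        (fderiv ℝ g (polarAt z (ρ, θ)) (Complex.exp (θ * Complex.I))) ρ := fun ρ =>
      (hg.differentiable one_ne_zero _).hasFDerivAt.comp_hasDerivAt ρ
        (hasDerivAt_polarAt_radius z ρ θ)
    have hiso : Isometry fun ρ : ℝ => polarAt z (ρ, θ) := Isometry.of_dist_eq fun ρ ρ' => by
      simp [polarAt, dist_eq_norm, ← sub_mul, ← Complex.ofReal_sub, Complex.norm_exp_ofReal_mul_I]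
    have hc : HasCompactSupport fun ρ : ℝ => g (polarAt z (ρ, θ)) :=
      hgc.comp_isClosedEmbedding hiso.isClosedEmbedding
    have hd : ContDiff ℝ 1 fun ρ : ℝ => g (polarAt z (ρ, θ)) :=
      hg.comp (contDiff_const.add (Complex.ofRealCLM.contDiff.mul
        (contDiff_const (c := Complex.exp (θ * Complex.I)))))
    have hFTC := hc.integral_Ioi_deriv_eq hd 0
    simp only [(hderiv _).deriv] at hFTC
    simpa [polarAt] using hFTC
  rw [polarCoord_target, Measure.volume_eq_prod, ← setIntegral_prod_swap, setIntegral_prod]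
  · simp [hray, two_mul, add_smul, Real.pi_nonneg]
  · exact (integrableOn_fderiv_polarAt hg hgc z
      (v := fun θ => Complex.exp (θ * Complex.I)) (by fun_prop)).swap

theorem integral_fderiv_angular [CompleteSpace E] (hg : ContDiff ℝ 1 g) (hgc : HasCompactSupport g)
    (z : ℂ) :
    ∫ p in polarCoord.target,
      fderiv ℝ g (polarAt z p) (Complex.I * Complex.exp (p.2 * Complex.I)) = 0 := by
  have hcircle : ∀ ρ ∈ Ioi (0 : ℝ), ∫ θ in Ioo (-Real.pi) Real.pi, fderiv ℝ g (polarAt z (ρ, θ))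
      (Complex.I * Complex.exp (θ * Complex.I)) = 0 := by
    intro ρ hρ
    have hderiv : ∀ θ : ℝ, HasDerivAt (fun θ : ℝ => g (polarAt z (ρ, θ)))
        (ρ • fderiv ℝ g (polarAt z (ρ, θ)) (Complex.I * Complex.exp (θ * Complex.I))) θ :=
      fun θ => by
        rw [← map_smul]
        exact (hg.differentiable one_ne_zero _).hasFDerivAt.comp_hasDerivAt θ
          (hasDerivAt_polarAt_angle z ρ θ)
    have hFTC := intervalIntegral.integral_eq_sub_of_hasDerivAt (a := -Real.pi) (b := Real.pi)
      (fun θ _ => hderiv θ) (Continuous.intervalIntegrable (by unfold polarAt; fun_prop) _ _)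
    have hends : polarAt z (ρ, Real.pi) = polarAt z (ρ, -Real.pi) := by
      simp [polarAt, Complex.exp_neg]
    rw [hends, sub_self, intervalIntegral.integral_smul,
      intervalIntegral.integral_of_le (neg_le_self Real.pi_nonneg),
      integral_Ioc_eq_integral_Ioo] at hFTC
    exact (smul_eq_zero_iff_right (ne_of_gt hρ)).1 hFTC
  rw [polarCoord_target, Measure.volume_eq_prod, setIntegral_prod]
  · exact setIntegral_eq_zero_of_forall_eq_zero hcircle
  · exact integrableOn_fderiv_polarAt hg hgc z
      (v := fun θ => Complex.I * Complex.exp (θ * Complex.I)) (by fun_prop)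

theorem integral_cauchyKernel_smul_dbar [CompleteSpace E] (hg : ContDiff ℝ 1 g)
    (hgc : HasCompactSupport g) (z : ℂ) :
    ∫ w, (w - z)⁻¹ • dbar g w = -(Real.pi : ℂ) • g z := by
  have hpolar : ∀ p ∈ polarCoord.target,
      p.1 • ((Complex.polarCoord.symm p)⁻¹ • dbar g (z + Complex.polarCoord.symm p)) =
        (2 : ℂ)⁻¹ • (fderiv ℝ g (polarAt z p) (Complex.exp (p.2 * Complex.I)) +
          Complex.I • fderiv ℝ g (polarAt z p) (Complex.I * Complex.exp (p.2 * Complex.I))) := by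
    intro p hp
    have hp0 : (p.1 : ℂ) ≠ 0 := Complex.ofReal_ne_zero.2 (ne_of_gt hp.1)
    rw [Complex.polarCoord_symm_apply, Complex.ofReal_cos, Complex.ofReal_sin,
      ← Complex.exp_mul_I, ← polarAt, ← conj_smul_dbar, ← Complex.coe_smul, smul_smul, mul_inv,
      mul_inv_cancel_left₀ hp0, ← Complex.exp_conj, ← Complex.exp_neg]
    simp
  have hint : ∀ v : ℝ → ℂ, Continuous v →
      Integrable (fun p => fderiv ℝ g (polarAt z p) (v p.2)) (volume.restrict polarCoord.target) :=
    fun v hv => integrableOn_fderiv_polarAt hg hgc z hv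
  calc ∫ w, (w - z)⁻¹ • dbar g w = ∫ w, w⁻¹ • dbar g (z + w) := by
        rw [← integral_add_left_eq_self _ z]
        simp only [add_sub_cancel_left]
    _ = (2 : ℂ)⁻¹ • (-(2 * Real.pi) • g z + Complex.I • 0) := by
        rw [← Complex.integral_comp_polarCoord_symm,
          setIntegral_congr_fun polarCoord.open_target.measurableSet hpolar, integral_smul,
          integral_add, integral_smul, integral_fderiv_angular hg hgc,
          integral_fderiv_radial hg hgc]
        · exact hint (fun θ => Complex.exp (θ * Complex.I)) (by fun_prop)
        · exact (hint (fun θ => Complex.I * Complex.exp (θ * Complex.I)) (by fun_prop)).smul _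
    _ = -(Real.pi : ℂ) • g z := by
        rw [← Complex.coe_smul, smul_zero, add_zero, smul_smul]
        congr 1
        push_cast
        ring

end CauchyPompeiu

/-! ### Runge approximation -/

section CauchyTransform

open MeasureTheory

variable {L : Set ℂ} {g : ℂ → ℂ}

theorem continuous_cauchyKernel_mul_dbar (hg : ContDiff ℝ 1 g)
    (hL : ∀ z ∈ L, ∀ᶠ w in 𝓝 z, DifferentiableAt ℂ g w) :
    Continuous fun x : ℂ × L => (x.1 - x.2 : ℂ)⁻¹ * dbar g x.1 := by
  rw [continuous_iff_continuousAt]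
  rintro ⟨w, z⟩
  by_cases hw : w = z
  · have hzero : (fun x : ℂ × L => (x.1 - x.2 : ℂ)⁻¹ * dbar g x.1) =ᶠ[𝓝 (w, z)] fun _ => 0 := by
      filter_upwards [(continuous_fst.tendsto (w, z)).eventually (hw ▸ hL z z.2)] with x hx
      rw [dbar_eq_zero_of_differentiableAt hx, mul_zero]
    exact continuousAt_const.congr hzero.symm
  · exact ContinuousAt.mul (ContinuousAt.inv₀ (by fun_prop) (sub_ne_zero.2 hw))
      ((continuous_dbar hg).continuousAt.comp continuous_fst.continuousAt)

theorem exists_mem_eqOn_of_cauchyKernel_mem [CompactSpace L] {M : Submodule ℂ C(L, ℂ)}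
    (hM : IsClosed (M : Set C(L, ℂ))) (hg : ContDiff ℝ 1 g) (hgc : HasCompactSupport g)
    (hL : ∀ z ∈ L, ∀ᶠ w in 𝓝 z, DifferentiableAt ℂ g w)
    (hker : ∀ w ∉ L, dbar g w ≠ 0 → ∀ k : C(L, ℂ), (∀ z : L, k z = (w - z : ℂ)⁻¹) → k ∈ M) :
    ∃ h ∈ M, ∀ z : L, h z = g z := by
  let H : C(ℂ, C(L, ℂ)) := ContinuousMap.curry ⟨_, continuous_cauchyKernel_mul_dbar hg hL⟩
  have hH : ∀ w, dbar g w = 0 → H w = 0 := fun w hw => by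
    ext z
    simp [H, hw]
  have hHM : ∀ w, H w ∈ M := by
    intro w
    by_cases hw : dbar g w = 0
    · exact hH w hw ▸ M.zero_mem
    · have hwL : w ∉ L := fun h => hw (dbar_eq_zero_of_differentiableAt (hL w h).self_of_nhds)
      have hk : (dbar g w)⁻¹ • H w ∈ M := hker w hwL hw _ fun z => by
        simp [H, field]
      simpa only [smul_inv_smul₀ hw] using M.smul_mem (dbar g w) hk
  have : CompleteSpace M := hM.completeSpace_coe
  let H' : ℂ → M := fun w => ⟨H w, hHM w⟩
  have hint : Integrable H' := by
    refine (H.continuous.subtype_mk _).integrable_of_hasCompactSupport (hgc.mono' fun w hw => ?_)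
    exact support_dbar_subset fun h => hw (Subtype.ext (hH w h))
  refine ⟨(-(Real.pi : ℂ))⁻¹ • (∫ w, H' w : M), M.smul_mem _ (∫ w, H' w : M).2, fun z => ?_⟩
  have hz : ((∫ w, H' w : M) : C(L, ℂ)) z = -(Real.pi : ℂ) • g z := by
    rw [← integral_cauchyKernel_smul_dbar hg hgc]
    exact (((ContinuousMap.evalCLM ℂ z).comp M.subtypeL).integral_comp_comm hint).symm
  rw [ContinuousMap.smul_apply, hz]
  exact inv_smul_smul₀ (neg_ne_zero.2 (Complex.ofReal_ne_zero.2 Real.pi_ne_zero)) _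

end CauchyTransform

section Runge

variable {S L : Set ℂ}

/-- The algebra of the functions on `L` given by rational functions without poles in `S`. -/
def ratSubalgebra (hLS : L ⊆ S) : Subalgebra ℂ C(L, ℂ) where
  carrier := {h | ∃ R : RatFunc ℂ, NoPolesIn R S ∧ ∀ z : L, h z = R.eval (RingHom.id ℂ) z}
  mul_mem' := by
    rintro _ _ ⟨R, hR, hR'⟩ ⟨T, hT, hT'⟩
    refine ⟨R * T, hR.mul hT, fun z => ?_⟩
    rw [hR.eval_mul hT (hLS z.2), ← hR', ← hT', ContinuousMap.mul_apply]
  add_mem' := by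
    rintro _ _ ⟨R, hR, hR'⟩ ⟨T, hT, hT'⟩
    refine ⟨R + T, hR.add hT, fun z => ?_⟩
    rw [hR.eval_add hT (hLS z.2), ← hR', ← hT', ContinuousMap.add_apply]
  algebraMap_mem' c :=
    ⟨algebraMap _ _ (C c), noPolesIn_algebraMap _ _, fun z => by simp⟩

theorem cauchyKernel_mem_ratSubalgebra (hLS : L ⊆ S) {w : ℂ} (hw : w ∉ S) {k : C(L, ℂ)}
    (hk : ∀ z : L, k z = (w - z : ℂ)⁻¹) : k ∈ ratSubalgebra hLS := by
  have hD : ∀ z ∈ S, (C w - X).eval z ≠ 0 := fun z hz => by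
    rw [eval_sub, eval_C, eval_X, sub_ne_zero]
    exact fun h => hw (h ▸ hz)
  refine ⟨algebraMap _ _ 1 / algebraMap _ _ (C w - X), noPolesIn_div hD, fun z => ?_⟩
  rw [ratFunc_eval_div _ (hD z (hLS z.2)), hk]
  simp

theorem cauchyKernel_mem_topologicalClosure (hLS : L ⊆ S) [CompactSpace L] {w : ℂ}
    (hw : ∀ z ∈ L, ‖z‖ < ‖w‖) {k : C(L, ℂ)} (hk : ∀ z : L, k z = (w - z : ℂ)⁻¹) :
    k ∈ (ratSubalgebra hLS).topologicalClosure := by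
  let A := (ratSubalgebra hLS).topologicalClosure
  let u : C(L, ℂ) := ⟨fun z => w⁻¹ * z, by fun_prop⟩
  have hmem : u ∈ A := Subalgebra.le_topologicalClosure _
    ⟨algebraMap _ _ (C w⁻¹ * X), noPolesIn_algebraMap _ _, fun z => by
      rw [RatFunc.eval_algebraMap]
      simp [u]⟩
  have hnorm : ‖u‖ < 1 := by
    refine (ContinuousMap.norm_lt_iff _ one_pos).2 fun z => ?_
    have hz := hw z z.2
    simpa [u] using (inv_mul_lt_one₀ ((norm_nonneg _).trans_lt hz)).2 hz
  have hsum : ∑' i, u ^ i ∈ A := (Subalgebra.isClosed_topologicalClosure _).mem_of_tendsto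
    (summable_geometric_of_norm_lt_one hnorm).hasSum
    (Eventually.of_forall fun s => A.sum_mem fun i _ => A.pow_mem hmem i)
  have hgeom : ∀ z : L, (∑' i, u ^ i) z * (1 - w⁻¹ * z) = 1 := fun z =>
    DFunLike.congr_fun (geom_series_mul_neg u hnorm) z
  have hk' : k = w⁻¹ • ∑' i, u ^ i := by
    ext z
    have hw0 : w ≠ 0 := norm_pos_iff.1 ((norm_nonneg _).trans_lt (hw z z.2))
    rw [ContinuousMap.smul_apply, hk, eq_inv_of_mul_eq_one_left (hgeom z), smul_eq_mul,
      ← mul_inv, mul_sub, mul_one, mul_inv_cancel_left₀ hw0]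
  exact hk' ▸ A.smul_mem hsum _

theorem exists_contDiff_hasCompactSupport_eventuallyEq {K U : Set ℂ} (hK : IsCompact K)
    (hU : IsOpen U) (hKU : K ⊆ U) {f : ℂ → ℂ} (hf : ContDiffOn ℝ 1 f U) :
    ∃ g : ℂ → ℂ, ContDiff ℝ 1 g ∧ HasCompactSupport g ∧ g =ᶠ[𝓝ˢ K] f := by
  obtain ⟨L, hL, hKL, hLU⟩ := exists_compact_between hK hU hKU
  obtain ⟨φ, hφ1, hφ0, -⟩ := exists_contMDiffMap_one_nhds_of_subset_interior (n := 1)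
    (modelWithCornersSelf ℝ ℂ) hK.isClosed hKL
  have hsupp : tsupport (fun z => φ z • f z) ⊆ L :=
    closure_minimal (fun z hz => by_contra fun h => hz (by simp [hφ0 z h])) hL.isClosed
  refine ⟨fun z => φ z • f z, ?_, hL.of_isClosed_subset (isClosed_tsupport _) hsupp, ?_⟩
  · rw [← contMDiff_iff_contDiff]
    refine contMDiff_of_tsupport fun z hz => contMDiffAt_iff_contDiffAt.2 ?_
    exact φ.contMDiff.contDiff.contDiffAt.smul
      (hf.contDiffAt (hU.mem_nhds (hLU (hsupp hz))))
  · filter_upwards [hφ1] with z hz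
    rw [hz, one_smul]

theorem exists_ratFunc_dist_eval_lt (hS : IsClosed S) {n : ℝ} {U : Set ℂ} (hU : IsOpen U)
    (hSU : S ∩ Metric.closedBall 0 n ⊆ U) {f : ℂ → ℂ} (hf : DifferentiableOn ℂ f U) {ε : ℝ}
    (hε : 0 < ε) :
    ∃ R : RatFunc ℂ, NoPolesIn R S ∧
      ∀ z ∈ S ∩ Metric.closedBall 0 n, dist (f z) (R.eval (RingHom.id ℂ) z) < ε := by
  set K := S ∩ Metric.closedBall 0 n
  have hK : IsCompact K := (isCompact_closedBall _ _).inter_left hS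
  have : CompactSpace K := isCompact_iff_compactSpace.1 hK
  have hKS : K ⊆ S := inter_subset_left
  obtain ⟨g, hg, hgc, hgf⟩ := exists_contDiff_hasCompactSupport_eventuallyEq hK hU hSU
    ((hf.contDiffOn hU).restrict_scalars ℝ)
  have hgd : ∀ z ∈ K, ∀ᶠ w in 𝓝 z, DifferentiableAt ℂ g w := by
    intro z hz
    filter_upwards [(eventually_nhdsSet_iff_forall.1 hgf z hz).eventually_nhds,
      hU.mem_nhds (hSU hz)] with w hw hwU
    exact (hf.differentiableAt (hU.mem_nhds hwU)).congr_of_eventuallyEq hw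
  let A := (ratSubalgebra hKS).topologicalClosure
  -- A kernel with its pole in `S` has it outside the disc, so it is a limit of polynomials.
  obtain ⟨h, hh, hhg⟩ := exists_mem_eqOn_of_cauchyKernel_mem (M := Subalgebra.toSubmodule A)
    (Subalgebra.isClosed_topologicalClosure _) hg hgc hgd fun w hwK _ k hk => by
      by_cases hwS : w ∈ S
      · have hwn : n < ‖w‖ := by simpa using fun h => hwK ⟨hwS, h⟩
        refine cauchyKernel_mem_topologicalClosure hKS (fun z hz => ?_) hk
        exact (mem_closedBall_zero_iff.1 hz.2).trans_lt hwn
      · exact Subalgebra.le_topologicalClosure _ (cauchyKernel_mem_ratSubalgebra hKS hwS hk)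
  obtain ⟨k, ⟨R, hR, hkR⟩, hk⟩ := Metric.mem_closure_iff.1 hh ε hε
  refine ⟨R, hR, fun z hz => ?_⟩
  have hdist := (ContinuousMap.dist_apply_le_dist (f := h) (g := k) ⟨z, hz⟩).trans_lt hk
  rwa [hhg, hkR, (eventually_nhdsSet_iff_forall.1 hgf z hz).self_of_nhds] at hdist

theorem exists_ratFunc_dist_iteratedDeriv_lt (hS : IsClosed S) (n : ℝ) {U : Set ℂ}
    (hU : IsOpen U) (hSU : S ⊆ U) {f : ℂ → ℂ} (hf : DifferentiableOn ℂ f U) (k : ℕ) {ε : ℝ}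
    (hε : 0 < ε) :
    ∃ R : RatFunc ℂ, NoPolesIn R S ∧ ∀ l ≤ k, ∀ z ∈ S ∩ Metric.closedBall 0 n,
      dist (iteratedDeriv l f z) (ratDeriv l R z) < ε := by
  set K := S ∩ Metric.closedBall 0 n
  have hK : IsCompact K := (isCompact_closedBall _ _).inter_left hS
  obtain ⟨δ, hδ, hδU⟩ := hK.exists_cthickening_subset_open hU (inter_subset_left.trans hSU)
  obtain ⟨r, hr⟩ := hK.cthickening.isBounded.subset_closedBall (0 : ℂ) (s := Metric.cthickening δ K)
  have hunion : S ∪ Metric.cthickening δ K ⊆ U := union_subset hSU hδU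
  choose R hR hRf using fun j : ℕ => exists_ratFunc_dist_eval_lt
    (hS.union Metric.isClosed_cthickening) hU (inter_subset_left.trans hunion) hf (n := r)
    (Nat.one_div_pos_of_nat (α := ℝ) (n := j))
  have hV : IsOpen (Metric.thickening δ K) := Metric.isOpen_thickening
  have hVS : Metric.thickening δ K ⊆ S ∪ Metric.cthickening δ K :=
    (Metric.thickening_subset_cthickening δ K).trans subset_union_right
  have hconv : TendstoUniformlyOn (fun j z => (R j).eval (RingHom.id ℂ) z) f atTop
      (Metric.thickening δ K) := by
    refine Metric.tendstoUniformlyOn_iff.2 fun η hη => ?_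
    filter_upwards [(tendsto_one_div_add_atTop_nhds_zero_nat (𝕜 := ℝ)).eventually_lt_const hη]
      with j hj z hz
    exact (hRf j z ⟨hVS hz, hr (Metric.thickening_subset_cthickening δ K hz)⟩).trans hj
  have hderiv : ∀ l : ℕ, TendstoUniformlyOn (fun j => ratDeriv l (R j)) (iteratedDeriv l f)
      atTop K := fun l =>
    (tendstoLocallyUniformlyOn_iff_forall_isCompact hV).1
      (tendstoLocallyUniformlyOn_iteratedDeriv hconv.tendstoLocallyUniformlyOn
        (fun j => ((hR j).mono hVS).differentiableOn) hV l) K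
      (Metric.self_subset_thickening hδ K) hK
  have hsmall : ∀ᶠ j in atTop, ∀ l ∈ Iic k, ∀ z ∈ K,
      dist (iteratedDeriv l f z) (ratDeriv l (R j) z) < ε :=
    (finite_Iic k).eventually_all.2 fun l _ => Metric.tendstoUniformlyOn_iff.1 (hderiv l) ε hε
  obtain ⟨j, hj⟩ := hsmall.exists
  exact ⟨R j, (hR j).mono subset_union_left, hj⟩

end Runge

/-! ### Density -/

section Density

variable {Ω : Set ℂ} {R : RatFunc ℂ}

/-- The rational functions without poles in the closure of `Ω`, as a subset of `A^∞(Ω)`. -/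
def ratSet (hΩ : IsOpen Ω) : Set (AInfty Ω) :=
  {f | ∃ (R : RatFunc ℂ) (hR : NoPolesIn R (closure Ω)), f = AInfty.ofRat hΩ R hR}

theorem holoClosure_subset_closure_ratSet (hΩ : IsOpen Ω) :
    holoClosure Ω ⊆ closure (ratSet hΩ) := by
  rintro f ⟨U, h, hU, hΩU, hh, hfh⟩
  choose R hR hRh using fun k : ℕ => exists_ratFunc_dist_iteratedDeriv_lt isClosed_closure k hU hΩU
    hh k (Nat.one_div_pos_of_nat (α := ℝ) (n := k))
  refine mem_closure_of_tendsto (b := atTop) (f := fun k => AInfty.ofRat hΩ (R k) (hR k)) ?_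
    (Eventually.of_forall fun k => ⟨_, _, rfl⟩)
  refine AInfty.tendsto_of_tendstoUniformlyOn_bar fun l n => ?_
  rw [Metric.tendstoUniformlyOn_iff]
  intro ε hε
  filter_upwards [eventually_ge_atTop l, eventually_ge_atTop n,
    tendsto_one_div_add_atTop_nhds_zero_nat.eventually_lt_const hε] with k hlk hnk hk z hz
  have hcont : ContinuousOn (iteratedDeriv l h) (closure Ω) :=
    (differentiableOn_iteratedDeriv hh hU l).continuousOn.mono hΩU
  rw [AInfty.bar_eqOn_closure hΩ hfh hcont (fun _ _ => rfl) hz.1,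
    AInfty.bar_ofRat hΩ (hR k) l hz.1]
  exact (hRh k l hlk z
    ⟨hz.1, Metric.closedBall_subset_closedBall (by exact_mod_cast hnk) hz.2⟩).trans hk

theorem NoPolesIn.add_algebraMap {K : Set ℂ} (hR : NoPolesIn R K) (P : ℂ[X]) :
    NoPolesIn (R + algebraMap ℂ[X] (RatFunc ℂ) P) K :=
  hR.add (noPolesIn_algebraMap P K)

theorem ratDeriv_add_algebraMap (P : ℂ[X]) (l : ℕ) {z : ℂ} (hz : R.denom.eval z ≠ 0) :
    ratDeriv l (R + algebraMap ℂ[X] (RatFunc ℂ) P) z =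
      ratDeriv l R z + (derivative^[l] P).eval z := by
  have hR : NoPolesIn R {z | R.denom.eval z ≠ 0} := fun _ => id
  have hsum : (fun w => (R + algebraMap ℂ[X] (RatFunc ℂ) P).eval (RingHom.id ℂ) w) =ᶠ[𝓝 z]
      fun w => R.eval (RingHom.id ℂ) w + P.eval w := by
    filter_upwards [(isOpen_eval_ne_zero R.denom).mem_nhds hz] with w hw
    rw [hR.eval_add (noPolesIn_algebraMap P _) hw, RatFunc.eval_algebraMap, Algebra.algebraMap_self,
      RingHom.id_apply, eval₂_id]
  rw [ratDeriv, hsum.iteratedDeriv_eq, iteratedDeriv_fun_add (hR.contDiffAt hz l)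
    P.differentiable.contDiff.contDiffAt, iteratedDeriv_eval, ratDeriv]

theorem tendsto_ofRat_add_algebraMap (hΩ : IsOpen Ω) (hR : NoPolesIn R (closure Ω)) (P : ℂ[X]) :
    Tendsto (fun c : ℂ => AInfty.ofRat hΩ _ (hR.add_algebraMap (C c * P))) (𝓝 0)
      (𝓝 (AInfty.ofRat hΩ R hR)) := by
  refine AInfty.tendsto_of_tendstoUniformlyOn_bar fun l n => ?_
  obtain ⟨M, hM⟩ := (isCompact_closedBall (0 : ℂ) (n : ℝ)).exists_bound_of_continuousOn
    (derivative^[l] P).continuous.continuousOn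
  have hlim : Tendsto (fun c : ℂ => ‖c‖ * M) (𝓝 0) (𝓝 0) := by
    simpa only [norm_zero, zero_mul] using (continuous_norm.tendsto (0 : ℂ)).mul_const M
  rw [Metric.tendstoUniformlyOn_iff]
  intro ε hε
  filter_upwards [hlim.eventually_lt_const hε] with c hc z hz
  rw [AInfty.bar_ofRat hΩ hR l hz.1, AInfty.bar_ofRat hΩ (hR.add_algebraMap _) l hz.1,
    ratDeriv_add_algebraMap _ l (hR z hz.1), dist_self_add_right, iterate_derivative_C_mul,
    eval_mul, eval_C, norm_mul]
  exact (mul_le_mul_of_nonneg_left (hM z hz.2) (norm_nonneg c)).trans_lt hc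

theorem isPadeForm_ofRat (hΩ : IsOpen Ω) (h0 : (0 : ℂ) ∈ Ω) {p q : ℕ}
    (hR : NoPolesIn R (closure Ω)) (hp : R.num.natDegree ≤ p) (hq : R.denom.natDegree ≤ q) :
    IsPadeForm p q (AInfty.ofRat hΩ R hR).taylor R.num R.denom where
  natDegree_num_le := hp
  natDegree_denom_le := hq
  coeff_zero_ne_zero := by
    rw [coeff_zero_eq_eval_zero]
    exact hR 0 (subset_closure h0)
  X_pow_dvd := by
    rw [AInfty.denom_mul_taylor_ofRat hΩ h0 hR, sub_self]
    exact dvd_zero _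

theorem ofRat_mem_padeGood (hΩ : IsOpen Ω) (h0 : (0 : ℂ) ∈ Ω) {p q : ℕ}
    (hR : NoPolesIn R (closure Ω)) (hp : R.num.degree = p) (hq : R.denom.natDegree ≤ q) (s : ℕ) :
    AInfty.ofRat hΩ R hR ∈ padeGood Ω p q s := by
  have hform := isPadeForm_ofRat hΩ h0 hR (natDegree_eq_of_degree_eq_some hp).le hq
  have hpade : pade p q (AInfty.ofRat hΩ R hR).taylor = R :=
    hform.pade_eq.trans (RatFunc.num_div_denom R)
  refine ⟨hform.inD_of_isCoprime (RatFunc.isCoprime_num_denom R) hp, ?_, fun l _ z hz => ?_⟩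
  · rw [hpade]
    exact hR.mono inter_subset_left
  · rw [hpade, AInfty.bar_ofRat hΩ hR l hz.1, sub_self, norm_zero]
    exact Nat.one_div_pos_of_nat

theorem degree_num_add_C_mul_X_pow {K : Type*} [Field K] {R : RatFunc K} {p : ℕ}
    (hp : R.num.natDegree + R.denom.natDegree < p) {c : K} (hc : c ≠ 0) :
    (R + algebraMap K[X] (RatFunc K) (C c * X ^ (p - R.denom.natDegree))).num.degree = p := by
  have hdeg : (C c * X ^ (p - R.denom.natDegree) * R.denom).degree = (p : WithBot ℕ) := by
    rw [degree_mul, degree_C_mul_X_pow _ hc, degree_eq_natDegree R.denom_ne_zero, ← Nat.cast_add,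
      Nat.sub_add_cancel (by lia)]
  rw [ratFunc_num_add_algebraMap, degree_add_eq_right_of_degree_lt, hdeg]
  rw [hdeg]
  exact degree_le_natDegree.trans_lt (by exact_mod_cast (Nat.le_add_right _ _).trans_lt hp)

theorem ratSet_subset_closure_inter_padeGood (hΩ : IsOpen Ω) (h0 : (0 : ℂ) ∈ Ω)
    {F : Set (ℕ × ℕ)} (hF : ∀ m n, ∃ u ∈ F, m < u.1 ∧ n ≤ u.2) (s : ℕ) :
    ratSet hΩ ⊆ closure (holoClosure Ω ∩ ⋃ u ∈ F, padeGood Ω u.1 u.2 s) := by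
  rintro _ ⟨R, hR, rfl⟩
  obtain ⟨u, huF, hp, hq⟩ := hF (R.num.natDegree + R.denom.natDegree) R.denom.natDegree
  refine mem_closure_of_tendsto (b := 𝓝[≠] 0) ((tendsto_ofRat_add_algebraMap hΩ hR
    (X ^ (u.1 - R.denom.natDegree))).mono_left nhdsWithin_le_nhds) ?_
  filter_upwards [self_mem_nhdsWithin ] with c (hc : c ≠ 0)
  refine ⟨AInfty.ofRat_mem_holoClosure hΩ _, mem_iUnion₂.2 ⟨u, huF, ?_⟩⟩
  exact ofRat_mem_padeGood hΩ h0 _ (degree_num_add_C_mul_X_pow hp hc)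
    ((ratFunc_denom_add_algebraMap R _).symm ▸ hq) s

theorem holoClosure_subset_closure_inter_padeGood (hΩ : IsOpen Ω) (h0 : (0 : ℂ) ∈ Ω)
    {F : Set (ℕ × ℕ)} (hF : ∀ m n, ∃ u ∈ F, m < u.1 ∧ n ≤ u.2) (s : ℕ) :
    holoClosure Ω ⊆ closure (holoClosure Ω ∩ ⋃ u ∈ F, padeGood Ω u.1 u.2 s) :=
  (holoClosure_subset_closure_ratSet hΩ).trans
    (closure_minimal (ratSet_subset_closure_inter_padeGood hΩ h0 hF s) isClosed_closure)

theorem dense_val_preimage_of_subset_closure_inter {X : Type*} [TopologicalSpace X] {S U : Set X}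
    (h : S ⊆ closure (S ∩ U)) : Dense ((↑) ⁻¹' U : Set ↥(closure S)) := by
  rintro ⟨x, hx⟩
  rw [Topology.IsInducing.subtypeVal.closure_eq_preimage_closure_image, mem_preimage,
    Subtype.image_preimage_coe]
  exact closure_mono (inter_subset_inter_left U subset_closure)
    (closure_minimal h isClosed_closure hx)

end Density

theorem theorem4p2 (Ω : Set ℂ) (hΩ : IsOpen Ω) (h0 : (0 : ℂ) ∈ Ω)
    (F : Set (ℕ × ℕ))
    (hF : ∃ u : ℕ → ℕ × ℕ, (∀ m, u m ∈ F) ∧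
      Tendsto (fun m => (u m).1) atTop atTop ∧ Tendsto (fun m => (u m).2) atTop atTop) :
    IsGδ {f : ↥(closure (holoClosure Ω)) | (f : AInfty Ω) ∈ BSet Ω F} ∧
    Dense {f : ↥(closure (holoClosure Ω)) | (f : AInfty Ω) ∈ BSet Ω F} ∧
    (BSet Ω F).Nonempty := by
  have hlarge : ∀ m n, ∃ u ∈ F, m < u.1 ∧ n ≤ u.2 := fun m n => by
    obtain ⟨u, huF, hu1, hu2⟩ := hF
    obtain ⟨k, hm, hn⟩ := ((hu1.eventually_gt_atTop m).and (hu2.eventually_ge_atTop n)).exists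
    exact ⟨u k, huF k, hm, hn⟩
  let G (s : ℕ) : Set ↥(closure (holoClosure Ω)) := (↑) ⁻¹' ⋃ u ∈ F, padeGood Ω u.1 u.2 s
  have hBG : {f : ↥(closure (holoClosure Ω)) | (f : AInfty Ω) ∈ BSet Ω F} = ⋂ s, G s := by
    rw [← preimage_iInter, ← bSet_eq_iInter_padeGood]
    rfl
  have hopen (s : ℕ) : IsOpen (G s) :=
    (isOpen_biUnion fun u _ => isOpen_padeGood h0 u.1 u.2 s).preimage continuous_subtype_val
  have hdense (s : ℕ) : Dense (G s) := dense_val_preimage_of_subset_closure_inter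
    (holoClosure_subset_closure_inter_padeGood hΩ h0 hlarge s)
  have : CompleteSpace (AInfty Ω) := AInfty.completeSpace hΩ
  have : CompleteSpace ↥(closure (holoClosure Ω)) := isClosed_closure.completeSpace_coe
  have hB : Dense {f : ↥(closure (holoClosure Ω)) | (f : AInfty Ω) ∈ BSet Ω F} :=
    hBG ▸ dense_iInter_of_isOpen hopen hdense
  have : Nonempty ↥(closure (holoClosure Ω)) :=
    ⟨⟨_, subset_closure (AInfty.ofRat_mem_holoClosure hΩ (noPolesIn_algebraMap 0 _))⟩⟩
  obtain ⟨f, hf⟩ := hB.nonempty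
  exact ⟨hBG ▸ IsGδ.iInter_of_isOpen hopen, hB, f, hf⟩
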